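/- Let $S$ be an oriented pair of pants with boundary components $A_1,A_2,A_3$, each oriented by the opposite of the boundary orientation; indices are taken modulo $3$. Identify the interior of $S$ with a sphere with punctures $p_1,p_2,p_3$, where $p_i$ corresponds to $A_i$, and decompose it into two ideal triangles $T_+$, $T_-$ along disjoint lines $B_1,B_2,B_3$, where $B_i$ goes from $p_{i-1}$ to $p_{i+1}$ and $p_1,p_2,p_3$ occur clockwise in this order around $T_+$ (and counterclockwise around $T_-$). Consider a convex projective structure on $S$, with boundary locally corresponding to straight lines, whose monodromy $\rho\colon\pi_1(S)\to\mathrm{SL}_3(\mathbb R)$ is such that each $\rho(A_i)$ has three distinct positive eigenvalues $0<\lambda_i<\mu_i<\nu_i$, and set $\tau_i=\mu_i+\nu_i$. The unstable flag of an element of $\pi_1(S)$ conjugate to some $A_i$ is the flag $F^{(1)}\subset F^{(2)}\subset\mathbb R^3$, where $F^{(1)}$ is the eigenspace of its monodromy for the lowest eigenvalue and $F^{(2)}$ is the sum of $F^{(1)}$ and of the eigenspace for the second lowest eigenvalue. Each vertex of a lift of $T_\pm$ to the universal cover is fixed by such an element, whose unstable flag is associated to this vertex. For a flag $F$ let $f^{(a)}$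 be an arbitrary non-zero element of $\Lambda^a(F^{(a)})$. If $F_1,F_2,F_3$ are the flags associated to the vertices of a lift of $T_+$ corresponding to $p_1,p_2,p_3$, and $F_1',F_2',F_3'$ those associated to a lift of $T_-$, let $$\tau_{111}(T_+)=\log\left(\frac{f_1^{(2)}\wedge f_2^{(1)}}{f_2^{(1)}\wedge f_3^{(2)}}\,\frac{f_1^{(1)}\wedge f_3^{(2)}}{f_1^{(1)}\wedge f_2^{(2)}}\,\frac{f_2^{(2)}\wedge f_3^{(1)}}{f_1^{(2)}\wedge f_3^{(1)}}\right),$$ $$\tau_{111}(T_-)=\log\left(\frac{f_1^{\prime(2)}\wedge f_3^{\prime(1)}}{f_2^{\prime(2)}\wedge f_3^{\prime(1)}}\,\frac{f_1^{\prime(1)}\wedge f_2^{\prime(2)}}{f_1^{\prime(1)}\wedge f_3^{\prime(2)}}\,\frac{f_2^{\prime(1)}\wedge f_3^{\prime(2)}}{f_1^{\prime(2)}\wedge f_2^{\prime(1)}}\right).$$ For a lift of $B_i$, let $F_{i+1}$, $F_{i-1}$, $F_i$, $F_i'$ be the flags associated to its positive endpoint, its negative endpoint, and the third vertices of the adjacent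 lifts of $T_+$ and $T_-$, respectively, and let $$\sigma_1(B_i)=\log\left(-\frac{f_{i+1}^{(1)}\wedge f_{i-1}^{(1)}\wedge f_i^{(1)}}{f_{i+1}^{(1)}\wedge f_{i-1}^{(1)}\wedge f_i^{\prime(1)}}\,\frac{f_{i-1}^{(2)}\wedge f_i^{\prime(1)}}{f_{i-1}^{(2)}\wedge f_i^{(1)}}\right),\qquad \sigma_2(B_i)=\log\left(-\frac{f_{i+1}^{(1)}\wedge f_{i-1}^{(1)}\wedge f_i^{\prime(1)}}{f_{i+1}^{(1)}\wedge f_{i-1}^{(1)}\wedge f_i^{(1)}}\,\frac{f_{i+1}^{(2)}\wedge f_i^{(1)}}{f_{i+1}^{(2)}\wedge f_i^{\prime(1)}}\right).$$ Then, for $i=1,2,3$, $$\lambda_i=e^{\frac13\sigma_1(B_{i+1})+\frac23\sigma_2(B_{i+1})+\frac23\sigma_1(B_{i-1})+\frac13\sigma_2(B_{i-1})+\frac23\tau_{111}(T_+)+\frac23\tau_{111}(T_-)}$$ and $$\tau_i=\left(e^{-\sigma_1(B_{i+1})-\sigma_2(B_{i-1})}+1\right)e^{\frac13\sigma_1(B_{i+1})-\frac13\sigma_2(B_{i+1})-\frac13\sigma_1(B_{i-1})+\frac13\sigma_2(B_{i-1})-\frac13\tau_{111}(T_+)-\frac13\tau_{111}(T_-)}.$$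 -/

import Mathlib

open scoped MatrixGroups UpperHalfPlane

namespace Pants

/-! ### The projective plane, flags, and positive hyperbolic matrices -/

/-- The vector space `ℝ³`. -/
abbrev V : Type := Fin 3 → ℝ

/-- The real projective plane. -/
abbrev RP2 : Type := Projectivization ℝ V

/-- `RP2` carries the quotient topology of `ℝ³ ∖ {0}`. -/
noncomputable instance : TopologicalSpace RP2 :=
  TopologicalSpace.coinduced (fun v : {v : V // v ≠ 0} => Projectivization.mk ℝ v.1 v.2)
    inferInstance

/-- A subset of `RP2` is convex if it misses some projective line `ψ = 0` and is convex in the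
affine chart `ψ = 1` which is the complement of that line. -/
def IsConvex (Ω : Set RP2) : Prop :=
  ∃ ψ : V →ₗ[ℝ] ℝ, (∀ p ∈ Ω, ψ p.rep ≠ 0) ∧
    Convex ℝ {v : V | ψ v = 1 ∧ ∃ hv : v ≠ 0, Projectivization.mk ℝ v hv ∈ Ω}

/-- A flag `0 ⊂ F⁽¹⁾ ⊂ F⁽²⁾ ⊂ ℝ³`. -/
structure Flag where
  line : Submodule ℝ V
  plane : Submodule ℝ V
  finrank_line : Module.finrank ℝ line = 1
  finrank_plane : Module.finrank ℝ plane = 2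
  line_le_plane : line ≤ plane

/-- A choice of non-zero elements `f⁽¹⁾ ∈ Λ¹(F⁽¹⁾)` and `f⁽²⁾ ∈ Λ²(F⁽²⁾)`, encoded by vectors `u, w`
with `f⁽¹⁾ = u` and `f⁽²⁾ = u ∧ w`. Every pair of non-zero elements arises in this way, since
`Λ²(F⁽²⁾)` is a line and `w` may be rescaled freely. -/
structure Frame (F : Flag) where
  u : V
  w : V
  u_mem : u ∈ F.line
  w_mem : w ∈ F.plane
  indep : LinearIndependent ℝ ![u, w]

/-- The wedge product of three vectors, where `Λ³(ℝ³)` is identified with `ℝ` by the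
determinant. -/
noncomputable def wedge3 (a b c : V) : ℝ := (Matrix.of ![a, b, c]).det

/-- `f⁽¹⁾ ∧ g⁽¹⁾ ∧ h⁽¹⁾`. -/
noncomputable def wedge111 {F G H : Flag} (f : Frame F) (g : Frame G) (h : Frame H) : ℝ :=
  wedge3 f.u g.u h.u

/-- `f⁽²⁾ ∧ g⁽¹⁾`. -/
noncomputable def wedge21 {F G : Flag} (f : Frame F) (g : Frame G) : ℝ :=
  wedge3 f.u f.w g.u

/-- `f⁽¹⁾ ∧ g⁽²⁾`. -/
noncomputable def wedge12 {F G : Flag} (f : Frame F) (g : Frame G) : ℝ :=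
  wedge3 f.u g.u g.w

/-- `x` is an eigenvalue of the matrix `M`. -/
def IsEigenvalue (M : SL(3, ℝ)) (x : ℝ) : Prop :=
  Module.End.HasEigenvalue (Matrix.toLin' M.1) x

/-- The eigenvalues of `M` are `0 < l < m < n`. -/
structure HasSpectrum (M : SL(3, ℝ)) (l m n : ℝ) : Prop where
  pos : 0 < l
  lt₁ : l < m
  lt₂ : m < n
  eig₁ : IsEigenvalue M l
  eig₂ : IsEigenvalue M m
  eig₃ : IsEigenvalue M n

/-- `M` is positive hyperbolic: it has three distinct positive real eigenvalues. -/
def IsPosHyperbolic (M : SL(3, ℝ)) : Prop := ∃ l m n : ℝ, HasSpectrum M l m n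

/-- The smallest eigenvalue of a positive hyperbolic matrix. -/
noncomputable def IsPosHyperbolic.lam {M : SL(3, ℝ)} (h : IsPosHyperbolic M) : ℝ :=
  h.choose

/-- The middle eigenvalue of a positive hyperbolic matrix. -/
noncomputable def IsPosHyperbolic.mu {M : SL(3, ℝ)} (h : IsPosHyperbolic M) : ℝ :=
  h.choose_spec.choose

/-- The largest eigenvalue of a positive hyperbolic matrix. -/
noncomputable def IsPosHyperbolic.nu {M : SL(3, ℝ)} (h : IsPosHyperbolic M) : ℝ :=
  h.choose_spec.choose_spec.choose

theorem IsPosHyperbolic.hasSpectrum {M : SL(3, ℝ)} (h : IsPosHyperbolic M) :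
    HasSpectrum M h.lam h.mu h.nu :=
  h.choose_spec.choose_spec.choose_spec

/-- The eigenspace of `M` for the number `x`. -/
noncomputable def eigenspace (M : SL(3, ℝ)) (x : ℝ) : Submodule ℝ V :=
  Module.End.eigenspace (Matrix.toLin' M.1) x

theorem HasSpectrum.exists_span {M : SL(3, ℝ)} {l m n : ℝ} (h : HasSpectrum M l m n) :
    ∃ a b : V, LinearIndependent ℝ ![a, b] ∧
      eigenspace M l = Submodule.span ℝ {a} ∧ eigenspace M m = Submodule.span ℝ {b} := by
  obtain ⟨a, ha⟩ := Module.End.HasEigenvalue.exists_hasEigenvector h.eig₁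
  obtain ⟨b, hb⟩ := Module.End.HasEigenvalue.exists_hasEigenvector h.eig₂
  obtain ⟨c, hc⟩ := Module.End.HasEigenvalue.exists_hasEigenvector h.eig₃
  have h1 := h.lt₁
  have h2 := h.lt₂
  have hli : LinearIndependent ℝ ![a, b, c] := by
    refine Module.End.eigenvectors_linearIndependent' (Matrix.toLin' M.1) ![l, m, n] ?_ _ ?_
    · intro i j hij
      fin_cases i <;> fin_cases j <;> simp at hij ⊢ <;> linarith
    · intro i
      fin_cases i
      · exact ha
      · exact hb
      · exact hc
  have hspan : ∀ v : V, ∃ x y z : ℝ, v = x • a + y • b + z • c := by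
    intro v
    let B := basisOfLinearIndependentOfCardEqFinrank hli (by simp)
    refine ⟨B.repr v 0, B.repr v 1, B.repr v 2, ?_⟩
    have := B.sum_repr v
    simp only [Fin.sum_univ_three] at this
    simpa [B] using this.symm
  have hind : ∀ x y z : ℝ, x • a + y • b + z • c = 0 → x = 0 ∧ y = 0 ∧ z = 0 := by
    intro x y z hxyz
    have := Fintype.linearIndependent_iff.1 hli ![x, y, z] (by simpa [Fin.sum_univ_three])
    exact ⟨this 0, this 1, this 2⟩
  have hM : ∀ x y z t : ℝ, x • a + y • b + z • c ∈ eigenspace M t →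
      x * (l - t) = 0 ∧ y * (m - t) = 0 ∧ z * (n - t) = 0 := by
    intro x y z t ht
    apply hind
    have ht' := Module.End.mem_eigenspace_iff.1 ht
    rw [map_add, map_add, map_smul, map_smul, map_smul, ha.apply_eq_smul, hb.apply_eq_smul,
      hc.apply_eq_smul] at ht'
    rw [← sub_eq_zero] at ht'
    rw [← ht']
    module
  refine ⟨a, b, ?_, ?_, ?_⟩
  · rw [LinearIndependent.pair_iff]
    intro x y hxy
    obtain ⟨hx, hy, -⟩ := hind x y 0 (by simpa using hxy)
    exact ⟨hx, hy⟩
  · apply le_antisymm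
    · intro v hv
      obtain ⟨x, y, z, rfl⟩ := hspan v
      obtain ⟨-, hy, hz⟩ := hM x y z l hv
      have hy0 : y = 0 := (mul_eq_zero.1 hy).resolve_right (by linarith)
      have hz0 : z = 0 := (mul_eq_zero.1 hz).resolve_right (by linarith)
      simp [hy0, hz0, Submodule.mem_span_singleton]
    · rw [Submodule.span_singleton_le_iff_mem]
      exact ha.1
  · apply le_antisymm
    · intro v hv
      obtain ⟨x, y, z, rfl⟩ := hspan v
      obtain ⟨hx, -, hz⟩ := hM x y z m hv
      have hx0 : x = 0 := (mul_eq_zero.1 hx).resolve_right (by linarith)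
      have hz0 : z = 0 := (mul_eq_zero.1 hz).resolve_right (by linarith)
      simp [hx0, hz0, Submodule.mem_span_singleton]
    · rw [Submodule.span_singleton_le_iff_mem]
      exact hb.1

/-- The unstable flag of a positive hyperbolic matrix: its line is the eigenspace of the lowest
eigenvalue, its plane is generated by this line and the eigenspace of the second lowest
eigenvalue. -/
noncomputable def unstableFlag (M : SL(3, ℝ)) (h : IsPosHyperbolic M) : Flag where
  line := eigenspace M h.lam
  plane := eigenspace M h.lam ⊔ eigenspace M h.mu
  finrank_line := by
    obtain ⟨a, b, hab, hl, -⟩ := h.hasSpectrum.exists_span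
    rw [hl]
    exact finrank_span_singleton (hab.ne_zero 0)
  finrank_plane := by
    obtain ⟨a, b, hab, hl, hm⟩ := h.hasSpectrum.exists_span
    rw [hl, hm, ← Submodule.span_union]
    have hr : Set.range ![a, b] = {a} ∪ {b} := by
      ext v
      simp [eq_comm]
    rw [← hr]
    simpa using finrank_span_eq_card hab
  line_le_plane := le_sup_left

/-- Every flag admits frames. -/
instance (F : Flag) : Nonempty (Frame F) := by
  obtain ⟨⟨u, hu⟩, hu0, hspan⟩ := finrank_eq_one_iff'.1 F.finrank_line
  have hne : ¬ F.plane ≤ F.line := by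
    intro hle
    have := Submodule.finrank_mono hle
    rw [F.finrank_line, F.finrank_plane] at this
    omega
  obtain ⟨w, hw, hw'⟩ := SetLike.not_le_iff_exists.1 hne
  refine ⟨⟨u, w, hu, hw, ?_⟩⟩
  have hu0' : u ≠ 0 := fun h0 => hu0 (Subtype.ext h0)
  rw [LinearIndependent.pair_iff' hu0']
  rintro x rfl
  exact hw' (F.line.smul_mem x hu)

/-- A conjugate of a positive hyperbolic matrix is positive hyperbolic. -/
theorem IsPosHyperbolic.conj {M : SL(3, ℝ)} (h : IsPosHyperbolic M) (g : SL(3, ℝ)) :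
    IsPosHyperbolic (g * M * g⁻¹) := by
  have key : ∀ x, IsEigenvalue M x → IsEigenvalue (g * M * g⁻¹) x := by
    intro x hx
    obtain ⟨v, hv⟩ := Module.End.HasEigenvalue.exists_hasEigenvector hx
    have hg : g⁻¹.1 * g.1 = 1 := by
      rw [← Matrix.SpecialLinearGroup.coe_mul]
      simp
    have hgv : g⁻¹.1.mulVec (g.1.mulVec v) = v := by
      rw [Matrix.mulVec_mulVec, hg, Matrix.one_mulVec]
    refine Module.End.hasEigenvalue_of_hasEigenvector (x := g.1.mulVec v) ⟨?_, ?_⟩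
    · rw [Module.End.mem_eigenspace_iff]
      have hMv : M.1.mulVec v = x • v := by
        simpa [Matrix.toLin'_apply] using hv.apply_eq_smul
      rw [Matrix.toLin'_apply, Matrix.SpecialLinearGroup.coe_mul,
        Matrix.SpecialLinearGroup.coe_mul, ← Matrix.mulVec_mulVec, hgv, ← Matrix.mulVec_mulVec,
        hMv, Matrix.mulVec_smul]
    · intro h0
      rw [h0, Matrix.mulVec_zero] at hgv
      exact hv.2 hgv.symm
  have hs := h.hasSpectrum
  exact ⟨_, _, _, hs.pos, hs.lt₁, hs.lt₂, key _ hs.eig₁, key _ hs.eig₂, key _ hs.eig₃⟩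

/-! ### The pair of pants

The three-puncture sphere is realized as `ℍ / Γ(2)`, oriented by `ℍ`. Cutting the cusps off along
the horocycles of height `2` gives a compact pair of pants `S`, whose interior is homeomorphic to
the whole of `ℍ / Γ(2)`. -/

/-- The universal cover of the pair of pants `S`: the complement in the upper half-plane of the
`SL(2, ℤ)`-orbit of the open horodisc `im z > 2`. (These horodiscs have disjoint closures.) -/
def Cover : Type := {z : ℍ // ∀ g : SL(2, ℤ), (g • z).im ≤ 2}

instance : TopologicalSpace Cover := inferInstanceAs (TopologicalSpace {_z : ℍ // _})

/-- The boundary of the universal cover, which consists of the horocycles bounding the removed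
horodiscs. -/
def Cover.boundary : Set Cover := {x | ∃ g : SL(2, ℤ), (g • x.1).im = 2}

/-- The fundamental group of `S` is `Γ(2) / {±1}`, acting on the universal cover by deck
transformations. For convenience we work with `Γ(2)` itself; maps that are meant to be defined on
the fundamental group are required to kill `-1`. -/
abbrev Deck : Subgroup SL(2, ℤ) := CongruenceSubgroup.Gamma 2

/-- The action of `Γ(2)` on the universal cover of `S`. -/
noncomputable def Deck.act (g : Deck) (x : Cover) : Cover :=
  ⟨g.1 • x.1, fun h => by rw [← mul_smul]; exact x.2 (h * g.1)⟩

/-- The element `-1` of `Γ(2)`. -/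
def Deck.negOne : Deck := ⟨-1, by rw [CongruenceSubgroup.Gamma_mem]; decide⟩

/-- The matrices of the peripheral elements `A₁, A₂, A₃`. Here and below indices are taken
modulo `3`, so that the index `0` stands for `3`. -/
def peripheralMatrix : Fin 3 → SL(2, ℤ) :=
  ![⟨!![1, 0; -2, 1], by simp [Matrix.det_fin_two]⟩,
    ⟨!![1, 2; 0, 1], by simp [Matrix.det_fin_two]⟩,
    ⟨!![-1, 2; -2, 3], by simp [Matrix.det_fin_two]⟩]

/-- The lift of the ideal triangle `T₊` to `ℍ` is the ideal triangle with vertices `p₁ = ∞`,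
`p₂ = 1`, `p₃ = 0`, which occur clockwise in this order. Its sides are lifts of the lines
`B₁, B₂, B₃`, the lift of `Bᵢ` going from `pᵢ₋₁` to `pᵢ₊₁`.

`peripheral i` is the element `Aᵢ` of the fundamental group that fixes `pᵢ` and is represented by
the boundary component of `S` around `pᵢ`, oriented by the opposite of the boundary orientation.
For instance `A₁` is the translation `z ↦ z + 2`, and one has `A₃ A₂ A₁ = 1` in `Γ(2) / {±1}`. -/
def peripheral (i : Fin 3) : Deck :=
  ⟨peripheralMatrix i, by
    rw [CongruenceSubgroup.Gamma_mem]
    fin_cases i <;> decide⟩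

/-- On the other side of the lift of `Bᵢ` lies a lift of the triangle `T₋`, with vertices `pᵢ₋₁`,
`pᵢ₊₁` and `pᵢ' = Aᵢ₊₁ pᵢ` (that is, `p₁' = 1/2`, `p₂' = -1`, `p₃' = 2`). `peripheral' i` is the
peripheral element fixing `pᵢ'`, namely the conjugate of `Aᵢ` by `Aᵢ₊₁`. -/
def peripheral' (i : Fin 3) : Deck :=
  peripheral (i + 1) * peripheral i * (peripheral (i + 1))⁻¹

/-! ### Convex projective structures on the pair of pants -/

/-- A convex projective structure on the pair of pants `S`, with hyperbolic boundary holonomy, given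
by its developing map and its monodromy. (The projective charts of `S` are the local inverses of
the covering map followed by the developing map.) -/
structure ConvexProjectiveStructure where
  /-- The developing map. -/
  dev : Cover → RP2
  /-- The monodromy homomorphism. -/
  rho : Deck →* SL(3, ℝ)
  /-- The monodromy is defined on the fundamental group `Γ(2) / {±1}`. -/
  rho_negOne : rho Deck.negOne = 1
  equivariant : ∀ (g : Deck) (x : Cover), dev (Deck.act g x) = rho g • dev x
  /-- In the interior, the developing map is locally a chart with values in an open subset of the
  projective plane. -/
  isOpen_image : ∀ U : Set Cover, IsOpen U → Disjoint U Cover.boundary → IsOpen (dev '' U)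
  /-- At the boundary, the developing map locally is a chart with values in a half-plane
  `φ / ψ ≥ 0` of an open subset of the projective plane, and the boundary corresponds to the
  straight line `φ = 0`. -/
  boundary_straight : ∀ x ∈ Cover.boundary, ∃ (N : Set RP2) (φ ψ : V →ₗ[ℝ] ℝ),
    IsOpen N ∧ dev x ∈ N ∧ φ ≠ 0 ∧ (∀ p ∈ N, ψ p.rep ≠ 0) ∧
    (∀ p ∈ N, p ∈ Set.range dev ↔ 0 ≤ φ p.rep / ψ p.rep) ∧
    (∀ y : Cover, dev y ∈ N → (y ∈ Cover.boundary ↔ φ (dev y).rep = 0))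
  /-- Convexity: the developing map is a homeomorphism onto its image, which is a convex domain. -/
  isEmbedding : Topology.IsEmbedding dev
  convex : IsConvex (Set.range dev)
  /-- The boundary components have positive hyperbolic monodromy. (This excludes the degenerate
  boundary geodesics whose monodromy has a double eigenvalue.) -/
  hyperbolic : ∀ i, IsPosHyperbolic (rho (peripheral i))

namespace ConvexProjectiveStructure

variable (π : ConvexProjectiveStructure)

theorem hyperbolic' (i : Fin 3) : IsPosHyperbolic (π.rho (peripheral' i)) := by
  have h := (π.hyperbolic i).conj (π.rho (peripheral (i + 1)))
  rwa [peripheral', map_mul, map_mul, map_inv]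

/-- Goldman's boundary invariant `λᵢ`, the smallest eigenvalue of the monodromy of `Aᵢ`. -/
noncomputable def lam (i : Fin 3) : ℝ := (π.hyperbolic i).lam

/-- Goldman's boundary invariant `τᵢ = μᵢ + νᵢ`, the sum of the other two eigenvalues. -/
noncomputable def tau (i : Fin 3) : ℝ := (π.hyperbolic i).mu + (π.hyperbolic i).nu

/-- The unstable flag `Fᵢ` associated to the vertex `pᵢ` of the lift of `T₊`. -/
noncomputable def flag (i : Fin 3) : Flag := unstableFlag _ (π.hyperbolic i)

/-- The unstable flag `Fᵢ'` associated to the vertex `pᵢ'`. -/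
noncomputable def flag' (i : Fin 3) : Flag := unstableFlag _ (π.hyperbolic' i)

/-- An arbitrary choice of non-zero elements `fᵢ⁽ᵃ⁾ ∈ Λᵃ(Fᵢ⁽ᵃ⁾)` and `fᵢ'⁽ᵃ⁾ ∈ Λᵃ(Fᵢ'⁽ᵃ⁾)`. -/
structure Frames where
  f : ∀ i, Frame (π.flag i)
  f' : ∀ i, Frame (π.flag' i)

instance : Nonempty π.Frames :=
  ⟨⟨fun _ => Classical.choice inferInstance, fun _ => Classical.choice inferInstance⟩⟩

namespace Frames

variable {π} (c : π.Frames)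

/-- The triangle invariant `τ₁₁₁(T₊)`. -/
noncomputable def tau111Plus : ℝ :=
  Real.log (wedge21 (c.f 1) (c.f 2) / wedge12 (c.f 2) (c.f 0) *
    (wedge12 (c.f 1) (c.f 0) / wedge12 (c.f 1) (c.f 2)) *
    (wedge21 (c.f 2) (c.f 0) / wedge21 (c.f 1) (c.f 0)))

/-- The triangle invariant `τ₁₁₁(T₋)`, computed from the lift of `T₋` with vertices `p₁'`, `p₂`,
`p₃`; all lifts of `T₋` are translates of this one by deck transformations. -/
noncomputable def tau111Minus : ℝ :=
  Real.log (wedge21 (c.f' 1) (c.f 0) / wedge21 (c.f 2) (c.f 0) *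
    (wedge12 (c.f' 1) (c.f 2) / wedge12 (c.f' 1) (c.f 0)) *
    (wedge12 (c.f 2) (c.f 0) / wedge21 (c.f' 1) (c.f 2)))

/-- The shear invariant `σ₁(Bᵢ)`. -/
noncomputable def sigma1 (i : Fin 3) : ℝ :=
  Real.log (-(wedge111 (c.f (i + 1)) (c.f (i - 1)) (c.f i) /
      wedge111 (c.f (i + 1)) (c.f (i - 1)) (c.f' i) *
    (wedge21 (c.f (i - 1)) (c.f' i) / wedge21 (c.f (i - 1)) (c.f i))))

/-- The shear invariant `σ₂(Bᵢ)`. -/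
noncomputable def sigma2 (i : Fin 3) : ℝ :=
  Real.log (-(wedge111 (c.f (i + 1)) (c.f (i - 1)) (c.f' i) /
      wedge111 (c.f (i + 1)) (c.f (i - 1)) (c.f i) *
    (wedge21 (c.f (i + 1)) (c.f i) / wedge21 (c.f (i + 1)) (c.f' i))))

end Frames

end ConvexProjectiveStructure

end Pants

/-! The closed cone C over the developed image spans ℝ³ and contains no line: boundary points on
three different horocycles have supporting functionals, each vanishing at its own point and positive
at the other two. The monodromy preserves C up to sign, so power iteration puts extreme eigenvectors
of each ρ(Aᵢ) into C (`IsSharpCone.exists_eigenFrame`).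

Let eᵢ be the lowest eigenvector of ρ(Aᵢ) and qᵢ the functional cutting out its unstable plane. The
geometric core is qᵢ(eⱼ) > 0 for i ≠ j. If it failed, either C would contain a nonzero vector and
its negative (`EigenFrame.repr_two_pos`), or some eᵢ would be an eigenvector of ρ(Aⱼ) too. In the
second case conjugates of a commutator by powers of ρ(Aᵢ) tend to the identity, while the
corresponding deck transformations do not (`not_eigenvector`).

The rest is algebra. All wedge products are multiples of values of the qᵢ or of volumes of triples
of lines, the flags Fᵢ' being translates by Aᵢ₊₁, and positivity makes them nonzero. The relation
Aᵢ₋₁Aᵢ₊₁Aᵢ = 1 expresses each coordinate through log λ, log ν and the logarithms of the volumes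
(`sigma1_eq`, `sigma2_eq`, `tau111_add`). The volumes drop out by `logVol_succ_eq_pred` and
`logVol'_relation`, and λμν = 1 supplies μ. -/

namespace Pants

open Filter Topology

/-! ### Triples of vectors with supporting functionals -/

/-- Three vectors and three functionals with `φᵢ(xᵢ) = 0` and `φᵢ(xⱼ) > 0` for `i ≠ j` are
independent. -/
theorem det_ne_zero_of_support {φ : Fin 3 → V →ₗ[ℝ] ℝ} {x : Fin 3 → V}
    (h0 : ∀ i, φ i (x i) = 0) (hpos : ∀ i j, i ≠ j → 0 < φ i (x j)) :
    (Matrix.of fun i k => φ i (Pi.single k 1)).det ≠ 0 ∧ (Matrix.of x).det ≠ 0 := by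
  have hmul : (Matrix.of fun i j => φ i (x j)) =
      (Matrix.of fun i k => φ i (Pi.single k 1)) * (Matrix.of x).transpose := by
    ext i j
    have := LinearMap.pi_apply_eq_sum_univ (φ i) (x j)
    simp only [Matrix.of_apply, Matrix.mul_apply, Matrix.transpose_apply]
    rw [this]
    refine Finset.sum_congr rfl fun k _ => ?_
    rw [smul_eq_mul, mul_comm]
    congr 2
    ext m
    simp [Pi.single_apply, eq_comm]
  -- With zero diagonal only the two 3-cycles contribute to the determinant; both are even, so both
  -- terms are positive.
  have hdet : 0 < (Matrix.of fun i j => φ i (x j)).det := by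
    rw [Matrix.det_fin_three]
    simp only [Matrix.of_apply, h0]
    have h01 := hpos 0 1 (by decide)
    have h02 := hpos 0 2 (by decide)
    have h10 := hpos 1 0 (by decide)
    have h12 := hpos 1 2 (by decide)
    have h20 := hpos 2 0 (by decide)
    have h21 := hpos 2 1 (by decide)
    have := mul_pos (mul_pos h01 h12) h20
    have := mul_pos (mul_pos h02 h10) h21
    nlinarith
  rw [hmul, Matrix.det_mul, Matrix.det_transpose] at hdet
  exact ⟨left_ne_zero_of_mul hdet.ne', right_ne_zero_of_mul hdet.ne'⟩

theorem eq_zero_of_support {φ : Fin 3 → V →ₗ[ℝ] ℝ} {x : Fin 3 → V}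
    (h0 : ∀ i, φ i (x i) = 0) (hpos : ∀ i j, i ≠ j → 0 < φ i (x j)) {v : V}
    (hv : ∀ i, φ i v = 0) : v = 0 := by
  refine Matrix.eq_zero_of_mulVec_eq_zero (det_ne_zero_of_support h0 hpos).1 ?_
  ext i
  have := LinearMap.pi_apply_eq_sum_univ (φ i) v
  rw [hv i] at this
  rw [Pi.zero_apply, this]
  simp only [Matrix.mulVec, dotProduct, Matrix.of_apply]
  refine Finset.sum_congr rfl fun k _ => ?_
  rw [smul_eq_mul, mul_comm]
  congr 2
  ext m
  simp [Pi.single_apply, eq_comm]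

theorem functional_eq_zero_of_support {φ : Fin 3 → V →ₗ[ℝ] ℝ} {x : Fin 3 → V}
    (h0 : ∀ i, φ i (x i) = 0) (hpos : ∀ i j, i ≠ j → 0 < φ i (x j)) {f : V →ₗ[ℝ] ℝ}
    (hf : ∀ i, f (x i) = 0) : f = 0 := by
  have hli : LinearIndependent ℝ x := by
    have := Matrix.linearIndependent_rows_of_det_ne_zero (det_ne_zero_of_support h0 hpos).2
    exact this
  let B := basisOfLinearIndependentOfCardEqFinrank hli (by simp)
  refine B.ext fun i => ?_
  simpa [B] using hf i

/-! ### Sharp cones, power iteration and eigenbases -/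

/-- Closed convex cones with compact sections and non-empty interior. -/
structure IsSharpCone (C : Set V) : Prop where
  isClosed : IsClosed C
  add_mem : ∀ v ∈ C, ∀ w ∈ C, v + w ∈ C
  smul_mem : ∀ a : ℝ, 0 ≤ a → ∀ v ∈ C, a • v ∈ C
  exists_pos : ∃ θ : V →ₗ[ℝ] ℝ, ∀ v ∈ C, v ≠ 0 → 0 < θ v
  eq_zero_of_vanish : ∀ f : V →ₗ[ℝ] ℝ, (∀ v ∈ C, f v = 0) → f = 0

namespace IsSharpCone

variable {C : Set V} (hC : IsSharpCone C)
include hC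

theorem eq_zero_of_neg_mem {v : V} (h : v ∈ C) (h' : -v ∈ C) : v = 0 := by
  obtain ⟨θ, hθ⟩ := hC.exists_pos
  by_contra h0
  have h1 := hθ v h h0
  have h2 := hθ _ h' (neg_ne_zero.2 h0)
  rw [map_neg] at h2
  linarith

/-- If a linear map preserving the cone is diagonal in some basis, then the component of a vector
of the cone for the dominating eigenvalue lies in the cone. -/
theorem dominating_mem {L : V →ₗ[ℝ] V} (hL : ∀ v ∈ C, L v ∈ C) {b : Module.Basis (Fin 3) ℝ V}
    {r : Fin 3 → ℝ} (hr : ∀ i, L (b i) = r i • b i) {k : Fin 3} (hk : 0 < r k) {v : V}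
    (hv : v ∈ C) (hdom : ∀ i, i ≠ k → b.repr v i = 0 ∨ |r i| < r k) :
    b.repr v k • b k ∈ C := by
  -- Power iteration: (r k)⁻ⁿ Lⁿ v stays in C, and its coordinates other than the k-th are zero or
  -- decay geometrically.
  have hpow : ∀ n : ℕ, (L ^ n) v ∈ C := by
    intro n
    induction n with
    | zero => simpa
    | succ n ih => rw [pow_succ']; exact hL _ ih
  have hformula : ∀ n : ℕ, (L ^ n) v = ∑ i, (b.repr v i * r i ^ n) • b i := by
    intro n
    induction n with
    | zero => simp [b.sum_repr]
    | succ n ih =>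
      rw [pow_succ', Module.End.mul_apply, ih, map_sum]
      refine Finset.sum_congr rfl fun i _ => ?_
      rw [map_smul, hr, smul_smul]
      ring_nf
  have hmem : ∀ n : ℕ, ∑ i, (b.repr v i * (r i / r k) ^ n) • b i ∈ C := by
    intro n
    have := hC.smul_mem ((r k)⁻¹ ^ n) (by positivity) _ (hpow n)
    rw [hformula, Finset.smul_sum] at this
    convert this using 2 with i
    rw [smul_smul, div_eq_mul_inv, mul_pow]
    ring_nf
  have hlim : Tendsto (fun n : ℕ => ∑ i, (b.repr v i * (r i / r k) ^ n) • b i) atTop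
      (𝓝 (∑ i, (if i = k then b.repr v k else 0) • b i)) := by
    refine tendsto_finsetSum _ fun i _ => Tendsto.smul_const ?_ _
    split_ifs with h
    · subst h
      simp [hk.ne']
    · rcases hdom i h with h0 | h0
      · simp [h0]
      · have : |r i / r k| < 1 := by
          rw [abs_div, abs_of_pos hk, div_lt_one hk]
          exact h0
        simpa using (tendsto_pow_atTop_nhds_zero_of_abs_lt_one this).const_mul (b.repr v i)
  have := hC.isClosed.mem_of_tendsto hlim (Eventually.of_forall hmem)
  simpa using this

theorem exists_repr_ne_zero (b : Module.Basis (Fin 3) ℝ V) (k : Fin 3) :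
    ∃ v ∈ C, b.repr v k ≠ 0 := by
  by_contra! h
  have := hC.eq_zero_of_vanish (b.coord k) h
  have h1 : b.coord k (b k) = 1 := by simp
  rw [this] at h1
  simp at h1

/-- The coordinate of a dominating eigenvector lying in the cone is nonnegative on the cone. -/
theorem repr_nonneg_of_dominating {L : V →ₗ[ℝ] V} (hL : ∀ v ∈ C, L v ∈ C)
    {b : Module.Basis (Fin 3) ℝ V} {r : Fin 3 → ℝ} (hr : ∀ i, L (b i) = r i • b i) {k : Fin 3}
    (hk : 0 < r k) (hdom : ∀ i, i ≠ k → |r i| < r k) (hb : b k ∈ C) {v : V} (hv : v ∈ C) :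
    0 ≤ b.repr v k := by
  have h := hC.dominating_mem hL hr hk hv fun i hi => Or.inr (hdom i hi)
  by_contra! hneg
  refine b.ne_zero k (hC.eq_zero_of_neg_mem hb ?_)
  have := hC.smul_mem (-(b.repr v k))⁻¹ (by rw [inv_nonneg]; linarith) _ h
  rw [smul_smul] at this
  convert this using 1
  rw [← neg_one_smul ℝ]
  congr 1
  have := hneg.ne
  field_simp

end IsSharpCone

/-- An eigenbasis of a positive hyperbolic matrix preserving the cone `C`, whose attracting and
repelling vectors belong to `C`. -/
structure EigenFrame (C : Set V) (M : SL(3, ℝ)) (r : Fin 3 → ℝ) where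
  b : Module.Basis (Fin 3) ℝ V
  pos : ∀ i, 0 < r i
  lt₁ : r 0 < r 1
  lt₂ : r 1 < r 2
  eig : ∀ i, M • b i = r i • b i
  zero_mem : b 0 ∈ C
  two_mem : b 2 ∈ C
  map_mem : ∀ v ∈ C, M • v ∈ C
  map_inv_mem : ∀ v ∈ C, M⁻¹ • v ∈ C
  zero_nonneg : ∀ v ∈ C, 0 ≤ b.repr v 0
  two_nonneg : ∀ v ∈ C, 0 ≤ b.repr v 2

/-- The linear map given by the action of a matrix. -/
noncomputable def act (M : SL(3, ℝ)) : V →ₗ[ℝ] V := DistribMulAction.toModuleEnd ℝ V M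

@[simp] theorem act_apply (M : SL(3, ℝ)) (v : V) : act M v = M • v := rfl

theorem HasSpectrum.exists_basis {M : SL(3, ℝ)} {l m n : ℝ} (h : HasSpectrum M l m n) :
    ∃ b : Module.Basis (Fin 3) ℝ V, ∀ i, M • b i = (![l, m, n] i) • b i := by
  obtain ⟨a, ha⟩ := Module.End.HasEigenvalue.exists_hasEigenvector h.eig₁
  obtain ⟨b, hb⟩ := Module.End.HasEigenvalue.exists_hasEigenvector h.eig₂
  obtain ⟨c, hc⟩ := Module.End.HasEigenvalue.exists_hasEigenvector h.eig₃
  have h1 := h.lt₁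
  have h2 := h.lt₂
  have hli : LinearIndependent ℝ ![a, b, c] := by
    refine Module.End.eigenvectors_linearIndependent' (Matrix.toLin' M.1) ![l, m, n] ?_ _ ?_
    · intro i j hij
      fin_cases i <;> fin_cases j <;> simp at hij ⊢ <;> linarith
    · intro i
      fin_cases i
      · exact ha
      · exact hb
      · exact hc
  refine ⟨basisOfLinearIndependentOfCardEqFinrank hli (by simp), fun i => ?_⟩
  fin_cases i
  · rw [coe_basisOfLinearIndependentOfCardEqFinrank]; exact ha.apply_eq_smul
  · rw [coe_basisOfLinearIndependentOfCardEqFinrank]; exact hb.apply_eq_smul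
  · rw [coe_basisOfLinearIndependentOfCardEqFinrank]; exact hc.apply_eq_smul

theorem inv_smul_eig {M : SL(3, ℝ)} {v : V} {a : ℝ} (ha : a ≠ 0) (h : M • v = a • v) :
    M⁻¹ • v = a⁻¹ • v := by
  rw [inv_smul_eq_iff, smul_comm, h, smul_smul, inv_mul_cancel₀ ha, one_smul]

/-- As M preserves C only up to sign, power iteration is run with M² and M⁻². It gives extreme
eigenvectors in C. Their eigenvalues for M are positive, which then excludes the sign -1. -/
theorem IsSharpCone.exists_eigenFrame {C : Set V} (hC : IsSharpCone C) {M : SL(3, ℝ)} {l m n : ℝ}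
    (h : HasSpectrum M l m n) {ε : ℝ} (hε : ε = 1 ∨ ε = -1) (hM : ∀ v ∈ C, ε • M • v ∈ C)
    {δ : ℝ} (hδ : δ = 1 ∨ δ = -1) (hM' : ∀ v ∈ C, δ • M⁻¹ • v ∈ C) :
    Nonempty (EigenFrame C M ![l, m, n]) := by
  obtain ⟨b, hb⟩ := h.exists_basis
  set r := ![l, m, n] with hr
  have h0 := h.pos
  have h1 := h.lt₁
  have h2 := h.lt₂
  have hpos : ∀ i, 0 < r i := by
    intro i
    fin_cases i
    · exact h0
    · exact h0.trans h1
    · exact (h0.trans h1).trans h2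
  have hle : ∀ i, i ≠ 2 → r i < r 2 := by
    intro i hi
    fin_cases i
    · exact h1.trans h2
    · exact h2
    · exact absurd rfl hi
  have hge : ∀ i, i ≠ 0 → r 0 < r i := by
    intro i hi
    fin_cases i
    · exact absurd rfl hi
    · exact h1
    · exact h1.trans h2
  have sq : ∀ (N : SL(3, ℝ)) (ε : ℝ), (ε = 1 ∨ ε = -1) → (∀ v ∈ C, ε • N • v ∈ C) →
      ∀ v ∈ C, act (N * N) v ∈ C := by
    intro N ε hε hN v hv
    have := hN _ (hN v hv)
    rw [smul_comm N ε, smul_smul] at this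
    rw [act_apply, mul_smul]
    rcases hε with rfl | rfl <;> simpa using this
  have eig2 : ∀ (b : Module.Basis (Fin 3) ℝ V), (∀ i, M • b i = r i • b i) →
      ∀ i, act (M * M) (b i) = (r i ^ 2) • b i := by
    intro b hb i
    rw [act_apply, mul_smul, hb, smul_comm, hb, smul_smul, pow_two]
  have eig2' : ∀ (b : Module.Basis (Fin 3) ℝ V), (∀ i, M • b i = r i • b i) →
      ∀ i, act (M⁻¹ * M⁻¹) (b i) = ((r i)⁻¹ ^ 2) • b i := by
    intro b hb i
    have := inv_smul_eig (hpos i).ne' (hb i)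
    rw [act_apply, mul_smul, this, smul_comm, this, smul_smul, pow_two]
  have dom2 : ∀ i, i ≠ 2 → |r i ^ 2| < r 2 ^ 2 := by
    intro i hi
    have := hpos i
    rw [abs_of_pos (by positivity)]
    have := hle i hi
    gcongr
  have dom0 : ∀ i, i ≠ 0 → |(r i)⁻¹ ^ 2| < (r 0)⁻¹ ^ 2 := by
    intro i hi
    have := hpos i
    have := hpos 0
    rw [abs_of_pos (by positivity)]
    have := hge i hi
    gcongr
  obtain ⟨v, hv, hv0⟩ := hC.exists_repr_ne_zero b 0
  obtain ⟨w, hw, hw0⟩ := hC.exists_repr_ne_zero b 2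
  have hv' := hC.dominating_mem (sq _ δ hδ hM') (eig2' b hb) (k := 0)
    (pow_pos (inv_pos.2 (hpos 0)) 2) hv fun i hi => Or.inr (dom0 i hi)
  have hw' := hC.dominating_mem (sq _ ε hε hM) (eig2 b hb) (k := 2)
    (pow_pos (hpos 2) 2) hw fun i hi => Or.inr (dom2 i hi)
  -- The extreme vectors are rescaled to the limits of the power iterations, which lie in C; the
  -- middle vector need not lie in C.
  let s : Fin 3 → ℝˣ := ![Units.mk0 _ hv0, 1, Units.mk0 _ hw0]
  let b' := b.unitsSMul s
  have hb' : ∀ i, M • b' i = r i • b' i := by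
    intro i
    simp only [b', Module.Basis.unitsSMul_apply, Units.smul_def]
    rw [smul_comm, hb, smul_comm]
  have h0mem : b' 0 ∈ C := by simpa [b', Module.Basis.unitsSMul_apply, s, Units.smul_def] using hv'
  have h2mem : b' 2 ∈ C := by simpa [b', Module.Basis.unitsSMul_apply, s, Units.smul_def] using hw'
  have hsign : ∀ (N : SL(3, ℝ)) (ε a : ℝ), (ε = 1 ∨ ε = -1) → 0 < a →
      N • b' 0 = a • b' 0 → (∀ v ∈ C, ε • N • v ∈ C) → ∀ v ∈ C, N • v ∈ C := by
    intro N ε a hε ha hN hNC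
    rcases hε with rfl | rfl
    · simpa using hNC
    · exfalso
      -- With sign -1, the vector -a • b' 0 would lie in C along with b' 0, although C contains no
      -- line.
      have h3 := hNC _ h0mem
      rw [hN] at h3
      have h4 := hC.smul_mem a⁻¹ (by positivity) _ h3
      rw [smul_smul, smul_smul] at h4
      refine b'.ne_zero 0 (hC.eq_zero_of_neg_mem h0mem ?_)
      convert h4 using 1
      rw [← neg_one_smul ℝ]
      congr 1
      field_simp
  exact ⟨{
    b := b'
    pos := hpos
    lt₁ := h1
    lt₂ := h2
    eig := hb'
    zero_mem := h0mem
    two_mem := h2mem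
    map_mem := hsign M ε (r 0) hε (hpos 0) (hb' 0) hM
    map_inv_mem := hsign M⁻¹ δ (r 0)⁻¹ hδ (inv_pos.2 (hpos 0))
      (inv_smul_eig (hpos 0).ne' (hb' 0)) hM'
    zero_nonneg := fun v hv => hC.repr_nonneg_of_dominating (sq _ δ hδ hM') (eig2' b' hb')
      (pow_pos (inv_pos.2 (hpos 0)) 2) dom0 h0mem hv
    two_nonneg := fun v hv => hC.repr_nonneg_of_dominating (sq _ ε hε hM) (eig2 b' hb')
      (pow_pos (hpos 2) 2) dom2 h2mem hv }⟩

/-! ### Positions of unstable planes and common eigenvectors -/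

/-- The matrix of an element of `SL(3, ℝ)` in a basis. -/
noncomputable def matrixIn (b : Module.Basis (Fin 3) ℝ V) : SL(3, ℝ) →* Matrix (Fin 3) (Fin 3) ℝ where
  toFun g := LinearMap.toMatrixAlgEquiv b (Matrix.toLinAlgEquiv' g.1)
  map_one' := by simp
  map_mul' g h := by simp

theorem matrixIn_apply (b : Module.Basis (Fin 3) ℝ V) (g : SL(3, ℝ)) (i j : Fin 3) :
    matrixIn b g i j = b.repr (g • b j) i := by
  simp only [matrixIn, MonoidHom.coe_mk, OneHom.coe_mk, LinearMap.toMatrixAlgEquiv_apply]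
  rfl

theorem det_matrixIn (b : Module.Basis (Fin 3) ℝ V) (g : SL(3, ℝ)) : (matrixIn b g).det = 1 := by
  have : (matrixIn b g) = LinearMap.toMatrix b b (Matrix.toLin' g.1) := rfl
  rw [this, LinearMap.det_toMatrix, LinearMap.det_toLin', g.2]

/-- Entries of the inverse become polynomials in those of the matrix, so their signs can be compared
and limits taken entrywise. -/
theorem matrixIn_inv (b : Module.Basis (Fin 3) ℝ V) (g : SL(3, ℝ)) :
    matrixIn b g⁻¹ = (matrixIn b g).adjugate := by
  have h : matrixIn b g⁻¹ * matrixIn b g = 1 := by rw [← map_mul]; simp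
  have h2 := Matrix.mul_adjugate (matrixIn b g)
  rw [det_matrixIn, one_smul] at h2
  calc matrixIn b g⁻¹ = matrixIn b g⁻¹ * (matrixIn b g * (matrixIn b g).adjugate) := by
        rw [h2, mul_one]
    _ = _ := by rw [← mul_assoc, h, one_mul]

theorem repr_smul (b : Module.Basis (Fin 3) ℝ V) (g : SL(3, ℝ)) (v : V) (i : Fin 3) :
    b.repr (g • v) i = ∑ j, matrixIn b g i j * b.repr v j := by
  have h := b.sum_repr v
  conv_lhs => rw [← h, Finset.smul_sum, map_sum, Finsupp.finsetSum_apply]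
  refine Finset.sum_congr rfl fun j _ => ?_
  rw [smul_comm, map_smul, Finsupp.smul_apply, matrixIn_apply, smul_eq_mul, mul_comm]

namespace EigenFrame

variable {C : Set V} {M : SL(3, ℝ)} {r : Fin 3 → ℝ} (E : EigenFrame C M r)
include E

theorem matrixIn_self : matrixIn E.b M = Matrix.diagonal r := by
  ext i j
  rw [matrixIn_apply, E.eig, Matrix.diagonal_apply]
  by_cases h : i = j
  · subst h; simp
  · simp [h]

theorem repr_smul_self (v : V) (i : Fin 3) : E.b.repr (M • v) i = r i * E.b.repr v i := by
  rw [repr_smul, E.matrixIn_self]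
  simp [Matrix.diagonal_apply]

theorem repr_inv_smul_self (v : V) (i : Fin 3) :
    E.b.repr (M⁻¹ • v) i = (r i)⁻¹ * E.b.repr v i := by
  have h := E.repr_smul_self (M⁻¹ • v) i
  rw [smul_inv_smul] at h
  rw [h, inv_mul_cancel_left₀ (E.pos i).ne']

/-- In the limit under backwards iteration only the lower coordinate of a nonnegative functional
survives. -/
theorem mul_repr_one_nonneg {α β : ℝ}
    (h : ∀ v ∈ C, 0 ≤ α * E.b.repr v 1 + β * E.b.repr v 2) {v : V} (hv : v ∈ C) :
    0 ≤ α * E.b.repr v 1 := by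
  have hmem : ∀ n : ℕ, 0 ≤ α * E.b.repr v 1 + β * E.b.repr v 2 * (r 1 / r 2) ^ n := by
    intro n
    induction n generalizing v with
    | zero => simpa using h v hv
    | succ n ih =>
      -- Replacing v by M⁻¹ v and multiplying by r 1 keeps the middle term and shrinks the top one
      -- by the factor r 1 / r 2.
      have h1 := ih (E.map_inv_mem v hv)
      rw [E.repr_inv_smul_self, E.repr_inv_smul_self] at h1
      have h2 := mul_nonneg (E.pos 1).le h1
      have p1 := (E.pos 1).ne'
      have p2 := (E.pos 2).ne'
      calc (0 : ℝ) ≤ _ := h2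
        _ = _ := by rw [pow_succ]; field_simp
  have hlim : Tendsto (fun n : ℕ => α * E.b.repr v 1 + β * E.b.repr v 2 * (r 1 / r 2) ^ n) atTop
      (𝓝 (α * E.b.repr v 1 + β * E.b.repr v 2 * 0)) := by
    refine tendsto_const_nhds.add (Tendsto.const_mul _ ?_)
    refine tendsto_pow_atTop_nhds_zero_of_lt_one ?_ ?_
    · exact (div_pos (E.pos 1) (E.pos 2)).le
    · rw [div_lt_one (E.pos 2)]; exact E.lt₂
  simpa using ge_of_tendsto' hlim hmem

/-- If `g` preserves the cone and fixes the repelling vector of `M` then it preserves its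
unstable plane. -/
theorem repr_two_smul_one_eq_zero (hC : IsSharpCone C) {g : SL(3, ℝ)} (hg : ∀ v ∈ C, g • v ∈ C)
    (hg' : ∀ v ∈ C, g⁻¹ • v ∈ C) {a : ℝ} (ha : g • E.b 0 = a • E.b 0) :
    matrixIn E.b g 2 1 = 0 := by
  set G := matrixIn E.b g with hG
  have h00 : G 0 0 = a := by rw [hG, matrixIn_apply, ha]; simp
  have h10 : G 1 0 = 0 := by rw [hG, matrixIn_apply, ha]; simp
  have h20 : G 2 0 = 0 := by rw [hG, matrixIn_apply, ha]; simp
  have ha0 : 0 ≤ a := by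
    have := E.zero_nonneg _ (hg _ E.zero_mem)
    rw [ha] at this
    simpa using this
  have hdet : a * (G 1 1 * G 2 2 - G 1 2 * G 2 1) = 1 := by
    have := det_matrixIn E.b g
    rw [← hG, Matrix.det_fin_three, h00, h10, h20] at this
    linarith
  have hapos : 0 < a := lt_of_le_of_ne ha0 (by rintro rfl; simp at hdet)
  have hinv : matrixIn E.b g⁻¹ = G.adjugate := matrixIn_inv _ _
  have h1 : ∀ v ∈ C, 0 ≤ G 2 1 * E.b.repr v 1 := by
    intro v hv
    refine E.mul_repr_one_nonneg (β := G 2 2) (fun v hv => ?_) hv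
    have := E.two_nonneg _ (hg v hv)
    rw [repr_smul, Fin.sum_univ_three, ← hG, h20] at this
    linarith
  -- The (2, 1) entry of g⁻¹ is -a G₂₁, of sign opposite to G₂₁. The two inequalities force G₂₁
  -- times the middle coordinate to vanish on C, and C spans.
  have h2 : ∀ v ∈ C, 0 ≤ (-(a * G 2 1)) * E.b.repr v 1 := by
    intro v hv
    refine E.mul_repr_one_nonneg (β := a * G 1 1) (fun v hv => ?_) hv
    have := E.two_nonneg _ (hg' v hv)
    rw [repr_smul, Fin.sum_univ_three, hinv, Matrix.adjugate_fin_three] at this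
    simp [h00, h10, h20] at this
    linarith
  have h3 : ∀ v ∈ C, G 2 1 * E.b.repr v 1 = 0 := by
    intro v hv
    have h4 := h1 v hv
    have h5 := h2 v hv
    have : 0 ≤ a * (-(G 2 1 * E.b.repr v 1)) := by linarith
    have := nonneg_of_mul_nonneg_right this hapos
    linarith
  obtain ⟨v, hv, hv1⟩ := hC.exists_repr_ne_zero E.b 1
  exact (mul_eq_zero.1 (h3 v hv)).resolve_right hv1

/-- If `g` preserves the cone and fixes the repelling vector of `M` then conjugation by powers
of `M` contracts the commutator of `M` and `g`. -/
theorem tendsto_conj_commutator (hC : IsSharpCone C) {g : SL(3, ℝ)} (hg : ∀ v ∈ C, g • v ∈ C)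
    (hg' : ∀ v ∈ C, g⁻¹ • v ∈ C) {a : ℝ} (ha : g • E.b 0 = a • E.b 0) (x : V) :
    Tendsto (fun n : ℕ => (M ^ n * (M * g * M⁻¹ * g⁻¹) * (M ^ n)⁻¹) • x) atTop (𝓝 x) := by
  set G := matrixIn E.b g with hG
  have h10 : G 1 0 = 0 := by rw [hG, matrixIn_apply, ha]; simp
  have h20 : G 2 0 = 0 := by rw [hG, matrixIn_apply, ha]; simp
  have h21 : G 2 1 = 0 := E.repr_two_smul_one_eq_zero hC hg hg' ha
  let T : ℕ → Matrix (Fin 3) (Fin 3) ℝ := fun n => matrixIn E.b (M ^ n * g * (M ^ n)⁻¹)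
  have hpow : ∀ n : ℕ, matrixIn E.b (M ^ n) = Matrix.diagonal (fun i => r i ^ n) := by
    intro n
    rw [map_pow, E.matrixIn_self, Matrix.diagonal_pow]
    rfl
  have hT : ∀ n i j, T n i j = G i j * (r i / r j) ^ n := by
    intro n i j
    have h : T n * matrixIn E.b (M ^ n) = matrixIn E.b (M ^ n) * G := by
      simp only [T, hG]
      rw [← map_mul, ← map_mul, inv_mul_cancel_right]
    rw [hpow] at h
    have h1 := congrFun (congrFun h i) j
    rw [Matrix.mul_diagonal, Matrix.diagonal_mul] at h1
    have := E.pos j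
    rw [div_pow]
    field_simp
    linarith
  have hlt : ∀ i j : Fin 3, i < j → r i < r j := by
    intro i j hij
    have h1 := E.lt₁
    have h2 := E.lt₂
    fin_cases i <;> fin_cases j <;> first | (exact absurd hij (by decide)) | skip
    · exact h1
    · exact h1.trans h2
    · exact h2
  -- G is upper triangular, and its entries above the diagonal are multiplied by (r i / r j) ^ n
  -- with r i < r j.
  have hTlim : Tendsto T atTop (𝓝 (Matrix.diagonal fun i => G i i)) := by
    refine tendsto_pi_nhds.2 fun i => tendsto_pi_nhds.2 fun j => ?_
    simp only [hT, Matrix.diagonal_apply]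
    rcases lt_trichotomy i j with h | h | h
    · rw [if_neg h.ne]
      have h1 : r i / r j < 1 := by rw [div_lt_one (E.pos j)]; exact hlt i j h
      have h2 := tendsto_pow_atTop_nhds_zero_of_lt_one (div_pos (E.pos i) (E.pos j)).le h1
      simpa using h2.const_mul (G i j)
    · subst h
      rw [if_pos rfl, div_self (E.pos i).ne']
      simp
    · have hz : G i j = 0 := by
        fin_cases i <;> fin_cases j <;> first | (exact absurd h (by decide)) | assumption
      rw [if_neg h.ne', hz]
      simp
  have hdet : (Matrix.diagonal fun i => G i i).det = 1 := by
    have h1 : Tendsto (fun n => (T n).det) atTop (𝓝 (Matrix.diagonal fun i => G i i).det) :=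
      ((continuous_id.matrix_det).tendsto _).comp hTlim
    simp only [T, det_matrixIn] at h1
    exact tendsto_nhds_unique h1 tendsto_const_nhds
  -- The conjugated commutator is the quotient of two consecutive terms of a convergent sequence of
  -- matrices of determinant 1, so it tends to 1.
  have hX : ∀ n : ℕ, matrixIn E.b (M ^ n * (M * g * M⁻¹ * g⁻¹) * (M ^ n)⁻¹) =
      T (n + 1) * (T n).adjugate := by
    intro n
    simp only [T]
    rw [← matrixIn_inv, ← map_mul]
    congr 1
    rw [pow_succ]
    group
  have hXlim : Tendsto (fun n => T (n + 1) * (T n).adjugate) atTop (𝓝 1) := by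
    have h1 : Tendsto (fun n => T (n + 1) * (T n).adjugate) atTop
        (𝓝 ((Matrix.diagonal fun i => G i i) * (Matrix.diagonal fun i => G i i).adjugate)) :=
      (hTlim.comp (tendsto_add_atTop_nat 1)).mul
        (((continuous_id.matrix_adjugate).tendsto _).comp hTlim)
    rwa [Matrix.mul_adjugate, hdet, one_smul] at h1
  have hexp : ∀ h : SL(3, ℝ), h • x = ∑ i, (∑ j, matrixIn E.b h i j * E.b.repr x j) • E.b i := by
    intro h
    rw [← E.b.sum_repr (h • x)]
    simp only [repr_smul]
  have hx : x = ∑ i, (∑ j, (1 : Matrix (Fin 3) (Fin 3) ℝ) i j * E.b.repr x j) • E.b i := by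
    rw [← map_one (matrixIn E.b), ← hexp, one_smul]
  conv => arg 3; rw [hx]
  simp only [hexp, hX]
  refine tendsto_finsetSum _ fun i _ => Tendsto.smul_const ?_ _
  refine tendsto_finsetSum _ fun j _ => Tendsto.mul_const _ ?_
  exact tendsto_pi_nhds.1 (tendsto_pi_nhds.1 hXlim i) j

/-- The face of the cone on the unstable plane contains the middle components of its vectors. -/
theorem repr_one_mem (hC : IsSharpCone C) {u : V} (hu : u ∈ C) (h2 : E.b.repr u 2 = 0) :
    E.b.repr u 1 • E.b 1 ∈ C := by
  refine hC.dominating_mem (L := act M) E.map_mem (r := r) E.eig (E.pos 1) hu fun i hi => ?_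
  fin_cases i
  · right
    rw [abs_of_pos (E.pos _)]
    exact E.lt₁
  · exact absurd rfl hi
  · exact Or.inl h2

/-- If the first coordinate vanished, u would lie on the middle eigenline and be an eigenvector; if
the second vanished, u would be a multiple of `E.b 0`. Nonnegativity of the first coordinate on C
gives its sign. -/
theorem face_decomp (hC : IsSharpCone C) {u : V} (hu : u ∈ C) (h2 : E.b.repr u 2 = 0)
    (hne : ∀ a : ℝ, u ≠ a • E.b 0) (hne' : ¬ ∃ a : ℝ, M • u = a • u) :
    0 < E.b.repr u 0 ∧ E.b.repr u 1 ≠ 0 ∧ E.b.repr u 1 • E.b 1 ∈ C ∧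
      u = E.b.repr u 0 • E.b 0 + E.b.repr u 1 • E.b 1 := by
  have hsum : u = E.b.repr u 0 • E.b 0 + E.b.repr u 1 • E.b 1 := by
    conv_lhs => rw [← E.b.sum_repr u, Fin.sum_univ_three, h2, zero_smul, add_zero]
  refine ⟨lt_of_le_of_ne (E.zero_nonneg u hu) fun h => hne' ⟨r 1, ?_⟩, fun h => hne (E.b.repr u 0) ?_,
    E.repr_one_mem hC hu h2, hsum⟩
  · rw [← h, zero_smul, zero_add] at hsum
    rw [hsum, smul_comm, E.eig, smul_comm]
  · rw [h, zero_smul, add_zero] at hsum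
    exact hsum

end EigenFrame

/-- The repelling vector of `M'` does not lie on the unstable plane of `M`, unless one of the two
repelling vectors is fixed by both matrices. -/
theorem EigenFrame.repr_two_pos {C : Set V} (hC : IsSharpCone C) {M M' : SL(3, ℝ)}
    {r r' : Fin 3 → ℝ} (E : EigenFrame C M r) (E' : EigenFrame C M' r')
    (h : ¬ ∃ a : ℝ, M' • E.b 0 = a • E.b 0) (h' : ¬ ∃ a : ℝ, M • E'.b 0 = a • E'.b 0) :
    0 < E.b.repr (E'.b 0) 2 := by
  refine lt_of_le_of_ne (E.two_nonneg _ E'.zero_mem) fun h0 => ?_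
  have hne : ∀ a : ℝ, E'.b 0 ≠ a • E.b 0 := by
    intro a ha
    refine h' ⟨r 0, ?_⟩
    rw [ha, smul_comm, E.eig, smul_comm]
  have hne' : ∀ a : ℝ, E.b 0 ≠ a • E'.b 0 := by
    intro a ha
    refine h ⟨r' 0, ?_⟩
    rw [ha, smul_comm, E'.eig, smul_comm]
  obtain ⟨hp, hq, hqC, hsum⟩ := E.face_decomp hC E'.zero_mem h0.symm hne h'
  set p := E.b.repr (E'.b 0) 0
  set q := E.b.repr (E'.b 0) 1
  -- The top coordinate for M' is nonnegative on C and vanishes on E'.b 0 = p E.b 0 + q E.b 1. Both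
  -- summands lie in C, so it vanishes on each of them: the situation is symmetric in M and M'.
  have hzero : E'.b.repr (E.b 0) 2 = 0 := by
    have h1 : E'.b.repr (E'.b 0) 2 = 0 := by simp
    conv at h1 => lhs; rw [hsum]
    rw [map_add, Finsupp.add_apply, map_smul, Finsupp.smul_apply, smul_eq_mul] at h1
    have h2 := E'.two_nonneg _ E.zero_mem
    have h3 := E'.two_nonneg _ hqC
    have h4 := mul_nonneg hp.le h2
    have h5 : p * (E'.b.repr (E.b 0)) 2 = 0 := by linarith
    exact (mul_eq_zero.1 h5).resolve_left hp.ne'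
  obtain ⟨hp', -, hqC', hsum'⟩ := E'.face_decomp hC E.zero_mem hzero hne' h
  set p' := E'.b.repr (E.b 0) 0
  set w := E'.b.repr (E.b 0) 1 • E'.b 1
  have hw : w = E.b 0 - p' • E'.b 0 := by rw [eq_sub_iff_add_eq, add_comm]; exact hsum'.symm
  have hw2 : E.b.repr w 2 = 0 := by
    rw [hw]
    simp [← h0]
  have hw1 : E.b.repr w 1 = - (p' * q) := by
    rw [hw]
    simp [q]
  -- The middle component of w for M is -p' q E.b 1. Both it and its negative are in C, which is
  -- impossible.
  have hmem := E.repr_one_mem hC hqC' hw2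
  rw [hw1] at hmem
  have h6 := hC.smul_mem p' hp'.le _ hqC
  rw [smul_smul] at h6
  rw [neg_smul] at hmem
  have h7 := hC.eq_zero_of_neg_mem h6 hmem
  rcases smul_eq_zero.1 h7 with h8 | h8
  · rcases mul_eq_zero.1 h8 with h9 | h9
    · exact hp'.ne' h9
    · exact hq h9
  · exact E.b.ne_zero 1 h8

/-! ### Horocycles and deck transformations -/

theorem im_smul_le (g : SL(2, ℤ)) (z : ℍ) (hc : g 1 0 ≠ 0) : (g • z).im ≤ 1 / z.im := by
  rw [ModularGroup.im_smul_eq_div_normSq, ModularGroup.denom_apply]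
  have hz := z.im_pos
  have h1 : (1 : ℝ) ≤ (g 1 0 : ℝ) ^ 2 := by
    have : (1 : ℤ) ≤ (g 1 0) ^ 2 := by
      have := sq_nonneg (g 1 0)
      have h0 : (g 1 0) ^ 2 ≠ 0 := pow_ne_zero 2 hc
      omega
    exact_mod_cast this
  -- |cz + d|² ≥ c² (im z)², and c² ≥ 1 because c is a nonzero integer.
  have h2 : z.im ^ 2 ≤ Complex.normSq ((g 1 0 : ℂ) * z + g 1 1) := by
    rw [Complex.normSq_apply]
    simp only [Complex.add_re, Complex.add_im, Complex.mul_re, Complex.mul_im, Complex.intCast_re,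
      Complex.intCast_im, UpperHalfPlane.coe_im, UpperHalfPlane.coe_re]
    nlinarith [sq_nonneg ((g 1 0 : ℝ) * z.re + g 1 1), sq_nonneg z.im]
  rw [div_le_div_iff₀ (lt_of_lt_of_le (by positivity) h2) hz]
  nlinarith

theorem im_smul_of_zero (g : SL(2, ℤ)) (z : ℍ) (hc : g 1 0 = 0) : (g • z).im = z.im := by
  rw [ModularGroup.im_smul_eq_div_normSq, ModularGroup.denom_apply, hc]
  have hdet := g.2
  rw [Matrix.det_fin_two] at hdet
  have hd : g 1 1 = 1 ∨ g 1 1 = -1 := by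
    have hc' : g.1 1 0 = 0 := hc
    rw [hc', mul_zero, sub_zero] at hdet
    exact Int.isUnit_iff.1 (IsUnit.of_mul_eq_one (g.1 0 0) (by rw [mul_comm]; exact hdet))
  rcases hd with h | h <;> simp [h]

theorem continuous_smul_upperHalfPlane (g : SL(2, ℤ)) : Continuous fun z : ℍ => g • z :=
  continuous_const_smul (Matrix.SpecialLinearGroup.map (Int.castRingHom ℝ) g)

theorem continuous_im_smul (g : SL(2, ℤ)) : Continuous fun z : ℍ => (g • z).im :=
  UpperHalfPlane.continuous_im.comp (continuous_smul_upperHalfPlane g)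

theorem dist_smul (g : SL(2, ℤ)) (z w : ℍ) : dist (g • z) (g • w) = dist z w :=
  _root_.dist_smul (Matrix.SpecialLinearGroup.map (Int.castRingHom ℝ) g) z w

namespace Cover

theorem continuous_val : Continuous fun x : Cover => x.1 := continuous_subtype_val

/-- A boundary point which lies in a horodisc of height `1` lies on its horocycle of height `2`. -/
theorem im_smul_eq_two {x : Cover} (hx : x ∈ boundary) {g : SL(2, ℤ)} (hg : 1 < (g • x.1).im) :
    (g • x.1).im = 2 := by
  obtain ⟨h, hh⟩ := hx
  have key : (h * g⁻¹) • g • x.1 = h • x.1 := by rw [smul_smul, inv_mul_cancel_right]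
  by_cases hc : (h * g⁻¹) 1 0 = 0
  · rw [← im_smul_of_zero _ (g • x.1) hc, key, hh]
  · have := im_smul_le _ (g • x.1) hc
    rw [key, hh, le_div_iff₀ (by linarith)] at this
    linarith

/-- The boundary is an infinite union of horocycles, so a uniform gap is needed: inside the horodisc
of height 1 the only boundary points are those of height exactly 2. Near a limit point only one
horocycle is therefore involved. -/
theorem isClosed_boundary : IsClosed boundary := by
  refine isClosed_of_closure_subset fun x hx => ?_
  have hnear : ∀ U : Set Cover, IsOpen U → x ∈ U → ∃ y ∈ U, y ∈ boundary := fun U hU hxU => by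
    obtain ⟨y, hy⟩ := mem_closure_iff.1 hx U hU hxU
    exact ⟨y, hy⟩
  -- Moving by less than log 2 from a point of height 2 keeps the height above 1.
  obtain ⟨y, hy, g, hg⟩ := hnear {y | dist x.1 y.1 < Real.log 2}
    (isOpen_lt (continuous_const.dist continuous_val) continuous_const)
    (by simpa using Real.log_pos (by norm_num))
  have hx1 : 1 < (g • x.1).im := by
    have h1 := UpperHalfPlane.im_div_exp_dist_le (g • y.1) (g • x.1)
    rw [hg, dist_smul, dist_comm] at h1
    have h2 : Real.exp (dist x.1 y.1) < 2 := by
      rw [← Real.lt_log_iff_exp_lt (by norm_num)]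
      exact hy
    refine lt_of_lt_of_le ?_ h1
    rw [lt_div_iff₀ (Real.exp_pos _)]
    linarith
  refine ⟨g, ?_⟩
  by_contra hne
  obtain ⟨w, ⟨hw1, hw2⟩, hw⟩ := hnear {w | 1 < (g • w.1).im ∧ (g • w.1).im ≠ 2}
    ((isOpen_lt continuous_const ((continuous_im_smul g).comp continuous_val)).inter
      (isOpen_ne_fun ((continuous_im_smul g).comp continuous_val) continuous_const)) ⟨hx1, hne⟩
  exact hw2 (im_smul_eq_two hw hw1)

/-- A path in the boundary stays on a horocycle. -/
theorem im_smul_eq_two_of_path {γ : unitInterval → Cover} (hγ : Continuous γ)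
    (hb : ∀ t, γ t ∈ boundary) {g : SL(2, ℤ)} (h0 : (g • (γ 0).1).im = 2) :
    (g • (γ 1).1).im = 2 := by
  have hcont : Continuous fun t => (g • (γ t).1).im :=
    (continuous_im_smul g).comp (continuous_val.comp hγ)
  by_contra hne
  have h1 : (g • (γ 1).1).im ≤ 1 := by
    by_contra! h
    exact hne (im_smul_eq_two (hb 1) h)
  -- Leaving the horocycle would require passing through height 3/2, inside the gap between 1 and 2.
  obtain ⟨t, ht⟩ := mem_range_of_exists_le_of_exists_ge hcont (c := 3 / 2)
    ⟨1, by linarith⟩ ⟨0, by rw [h0]; norm_num⟩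
  have h2 := im_smul_eq_two (hb t) (g := g) (by simp only at ht; linarith)
  simp only at ht
  linarith

end Cover

/-- Elements of `SL(2, ℤ)` taking the vertex `pᵢ` to `∞`. -/
def toInfinity : Fin 3 → SL(2, ℤ) :=
  ![⟨!![0, 1; -1, 0], by simp [Matrix.det_fin_two]⟩, 1,
    ⟨!![0, 1; -1, 1], by simp [Matrix.det_fin_two]⟩]

theorem toInfinity_mul_peripheral (i : Fin 3) :
    toInfinity i * (peripheral i).1 = ModularGroup.T ^ 2 * toInfinity i := by
  fin_cases i <;> decide

theorem toInfinity_mul_peripheral_pow (i : Fin 3) (n : ℕ) :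
    toInfinity i * (peripheral i).1 ^ n = ModularGroup.T ^ (2 * n) * toInfinity i := by
  induction n with
  | zero => simp
  | succ n ih =>
    rw [pow_succ', ← mul_assoc, toInfinity_mul_peripheral, mul_assoc, ih, ← mul_assoc, ← pow_add]
    ring_nf

/-- The commutator does not fix the cusp pᵢ. -/
theorem commutator_c_ne_zero (i j : Fin 3) (h : i ≠ j) :
    (toInfinity i * ((peripheral i).1 * (peripheral j).1 * (peripheral i).1⁻¹ *
      (peripheral j).1⁻¹) * (toInfinity i)⁻¹) 1 0 ≠ 0 := by
  fin_cases i <;> fin_cases j <;> first | exact absurd rfl h | decide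

theorem im_smul_pow_T (n : ℕ) (z : ℍ) : (ModularGroup.T ^ n • z).im = z.im := by
  have := UpperHalfPlane.modular_T_zpow_smul z n
  rw [zpow_natCast] at this
  rw [this, UpperHalfPlane.vadd_im]

/-- The translates run off horizontally, so |cz + d| tends to infinity when c ≠ 0. -/
theorem tendsto_im_smul_translate (g : SL(2, ℤ)) (hc : g 1 0 ≠ 0) (z : ℍ) :
    Tendsto (fun n : ℕ => (g • (ModularGroup.T ^ (2 * n))⁻¹ • z).im) atTop (𝓝 0) := by
  have hT : ∀ n : ℕ, (ModularGroup.T ^ (2 * n))⁻¹ • z = (-(2 * n) : ℝ) +ᵥ z := by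
    intro n
    have := UpperHalfPlane.modular_T_zpow_smul z (-(2 * n : ℕ))
    rw [zpow_neg, zpow_natCast] at this
    rw [this]
    push_cast
    rfl
  have hc1 : (1 : ℝ) ≤ |(g 1 0 : ℝ)| := by
    exact_mod_cast Int.one_le_abs hc
  simp only [ModularGroup.im_smul_eq_div_normSq g, ModularGroup.denom_apply, hT,
    UpperHalfPlane.vadd_im]
  refine tendsto_const_nhds.div_atTop ?_
  have hlin : Tendsto (fun n : ℕ => 4 * (n : ℝ) - (2 * |z.re| + 2 * |(g 1 1 : ℝ)| + 1)) atTop atTop :=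
    tendsto_atTop_add_const_right _ _
      (Tendsto.const_mul_atTop (by norm_num) tendsto_natCast_atTop_atTop)
  refine tendsto_atTop_mono (fun n => ?_) hlin
  rw [Complex.normSq_apply]
  simp only [Complex.add_re, Complex.add_im, Complex.mul_re, Complex.mul_im, Complex.intCast_re,
    Complex.intCast_im, UpperHalfPlane.coe_im, UpperHalfPlane.coe_re, UpperHalfPlane.vadd_re,
    UpperHalfPlane.vadd_im]
  set y : ℝ := -(2 * n) + z.re
  have hy : 2 * (n : ℝ) - |z.re| ≤ |y| := by
    have h1 := neg_abs_le y
    have h2 := le_abs_self z.re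
    simp only [y] at h1 ⊢
    linarith
  have h1 : |y| ≤ |(g 1 0 : ℝ) * y| := by
    rw [abs_mul]
    nlinarith [abs_nonneg y]
  have h2 : |(g 1 0 : ℝ) * y| ≤ |(g 1 0 : ℝ) * y + g 1 1| + |(g 1 1 : ℝ)| := by
    have := abs_sub ((g 1 0 : ℝ) * y + g 1 1) (g 1 1)
    rwa [add_sub_cancel_right] at this
  have h3 : 2 * |(g 1 0 : ℝ) * y + g 1 1| - 1 ≤ ((g 1 0 : ℝ) * y + g 1 1) ^ 2 := by
    rw [← sq_abs]
    nlinarith [sq_nonneg (|(g 1 0 : ℝ) * y + g 1 1| - 1)]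
  have h4 := sq_nonneg ((g 1 0 : ℝ) * z.im)
  nlinarith

/-- Conjugates of the commutator of two peripheral elements by powers of the first one do not
converge on the universal cover. -/
theorem not_tendsto_act_conj_commutator {i j : Fin 3} (h : i ≠ j) (x : Cover) :
    ¬ Tendsto (fun n : ℕ => Deck.act (peripheral i ^ n * (peripheral i * peripheral j *
      (peripheral i)⁻¹ * (peripheral j)⁻¹) * (peripheral i ^ n)⁻¹) x) atTop (𝓝 x) := by
  intro hlim
  have h1 : Tendsto (fun n : ℕ => (toInfinity i • (Deck.act (peripheral i ^ n * (peripheral i *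
      peripheral j * (peripheral i)⁻¹ * (peripheral j)⁻¹) * (peripheral i ^ n)⁻¹) x).1).im) atTop
      (𝓝 (toInfinity i • x.1).im) :=
    (((continuous_im_smul (toInfinity i)).comp Cover.continuous_val).tendsto x).comp hlim
  have h2 := tendsto_im_smul_translate _ (commutator_c_ne_zero i j h) (toInfinity i • x.1)
  refine (toInfinity i • x.1).im_pos.ne' (tendsto_nhds_unique h1 ?_)
  convert h2 using 2 with n
  have hinv : ((peripheral i).1 ^ n)⁻¹ * (toInfinity i)⁻¹ =
      (toInfinity i)⁻¹ * (ModularGroup.T ^ (2 * n))⁻¹ := by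
    rw [← mul_inv_rev, toInfinity_mul_peripheral_pow, mul_inv_rev]
  -- In the coordinate with pᵢ at infinity, Aᵢⁿ is translation by 2n. The outer one does not change
  -- heights and the inner one sends the height to 0.
  rw [← im_smul_pow_T (2 * n) ((toInfinity i * ((peripheral i).1 * (peripheral j).1 *
    (peripheral i).1⁻¹ * (peripheral j).1⁻¹) * (toInfinity i)⁻¹) • _)]
  congr 1
  simp only [Deck.act, smul_smul]
  congr 1
  simp only [Subgroup.coe_mul, Subgroup.coe_inv, SubmonoidClass.coe_pow]
  simp only [← mul_assoc]
  rw [toInfinity_mul_peripheral_pow]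
  simp only [mul_assoc]
  rw [← mul_assoc ((toInfinity i)⁻¹) _ (toInfinity i), ← hinv]
  simp

/-! ### Cones over convex domains and supporting lines -/

theorem continuous_mk : Continuous fun v : {v : V // v ≠ 0} => Projectivization.mk ℝ v.1 v.2 :=
  continuous_coinduced_rng

/-- The set of vectors representing points of an open subset of the projective plane is open. -/
theorem isOpen_lift {N : Set RP2} (hN : IsOpen N) :
    IsOpen {v : V | ∃ hv : v ≠ 0, Projectivization.mk ℝ v hv ∈ N} := by
  have h := (isOpen_compl_singleton (x := (0 : V))).isOpenMap_subtype_val _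
    (hN.preimage continuous_mk)
  convert h using 1
  ext v
  constructor
  · rintro ⟨hv, h⟩
    exact ⟨⟨v, hv⟩, h, rfl⟩
  · rintro ⟨⟨w, hw⟩, h, rfl⟩
    exact ⟨hw, h⟩

theorem exists_rep_eq_smul (v : V) (hv : v ≠ 0) :
    ∃ a : ℝ, a ≠ 0 ∧ (Projectivization.mk ℝ v hv).rep = a • v := by
  obtain ⟨a, ha⟩ := Projectivization.exists_smul_eq_mk_rep ℝ v hv
  exact ⟨a, a.ne_zero, ha.symm⟩

theorem mk_smul_eq {v : V} (hv : v ≠ 0) {a : ℝ} (h : a • v ≠ 0) :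
    Projectivization.mk ℝ (a • v) h = Projectivization.mk ℝ v hv := by
  rw [Projectivization.mk_eq_mk_iff']
  exact ⟨a, rfl⟩

/-- The cone over a subset of an affine chart of the projective plane. -/
def coneOver (Ω : Set RP2) (ψ : V →ₗ[ℝ] ℝ) : Set V :=
  {v | 0 < ψ v ∧ ∃ hv : v ≠ 0, Projectivization.mk ℝ v hv ∈ Ω}

section coneOver

variable {Ω : Set RP2} {ψ : V →ₗ[ℝ] ℝ}

theorem coneOver.smul_mem {v : V} (hv : v ∈ coneOver Ω ψ) {a : ℝ} (ha : 0 < a) :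
    a • v ∈ coneOver Ω ψ := by
  obtain ⟨h1, h0, h2⟩ := hv
  refine ⟨by rw [map_smul]; exact mul_pos ha h1, smul_ne_zero ha.ne' h0, ?_⟩
  rwa [mk_smul_eq h0]

theorem coneOver.add_mem
    (hconv : Convex ℝ {v : V | ψ v = 1 ∧ ∃ hv : v ≠ 0, Projectivization.mk ℝ v hv ∈ Ω})
    {v w : V} (hv : v ∈ coneOver Ω ψ) (hw : w ∈ coneOver Ω ψ) : v + w ∈ coneOver Ω ψ := by
  have hnorm : ∀ v ∈ coneOver Ω ψ, (ψ v)⁻¹ • v ∈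
      {v : V | ψ v = 1 ∧ ∃ hv : v ≠ 0, Projectivization.mk ℝ v hv ∈ Ω} := by
    intro v hv
    refine ⟨by rw [map_smul, smul_eq_mul, inv_mul_cancel₀ hv.1.ne'], ?_⟩
    exact (coneOver.smul_mem hv (inv_pos.2 hv.1)).2
  have hv1 := hv.1
  have hw1 := hw.1
  -- The weights are chosen so that the convex combination in the chart ψ = 1 is (v + w) / ψ (v +
  -- w).
  have h := hconv (hnorm v hv) (hnorm w hw) (a := ψ v / (ψ v + ψ w)) (b := ψ w / (ψ v + ψ w))
    (by positivity) (by positivity) (by field_simp)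
  have h' : (ψ v / (ψ v + ψ w)) • (ψ v)⁻¹ • v + (ψ w / (ψ v + ψ w)) • (ψ w)⁻¹ • w ∈
      coneOver Ω ψ := ⟨by rw [h.1]; exact one_pos, h.2⟩
  have := coneOver.smul_mem h' (add_pos hv1 hw1)
  convert this using 1
  rw [smul_add, smul_smul, smul_smul, smul_smul, smul_smul]
  congr 1
  · rw [show (ψ v + ψ w) * (ψ v / (ψ v + ψ w)) * (ψ v)⁻¹ = 1 by field_simp, one_smul]
  · rw [show (ψ v + ψ w) * (ψ w / (ψ v + ψ w)) * (ψ w)⁻¹ = 1 by field_simp, one_smul]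

theorem chart_ne_zero (hψ : ∀ p ∈ Ω, ψ p.rep ≠ 0) {v : V} (hv : v ≠ 0)
    (h : Projectivization.mk ℝ v hv ∈ Ω) : ψ v ≠ 0 := by
  intro h0
  obtain ⟨a, -, ha⟩ := exists_rep_eq_smul v hv
  refine hψ _ h ?_
  rw [ha, map_smul, h0, smul_zero]

theorem exists_mem_coneOver (hψ : ∀ p ∈ Ω, ψ p.rep ≠ 0) {p : RP2} (hp : p ∈ Ω) :
    ∃ v ∈ coneOver Ω ψ, ∃ hv : v ≠ 0, Projectivization.mk ℝ v hv = p := by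
  have h0 := hψ p hp
  have hne : ψ p.rep • p.rep ≠ 0 := smul_ne_zero h0 p.rep_nonzero
  have hmk : Projectivization.mk ℝ (ψ p.rep • p.rep) hne = p := by
    rw [mk_smul_eq p.rep_nonzero, Projectivization.mk_rep]
  refine ⟨ψ p.rep • p.rep, ⟨?_, hne, by rwa [hmk]⟩, hne, hmk⟩
  rw [map_smul, smul_eq_mul]
  exact mul_self_pos.2 h0

/-- A matrix preserving a convex subset of the projective plane preserves the cone over it up to
sign. -/
theorem exists_sign (hψ : ∀ p ∈ Ω, ψ p.rep ≠ 0)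
    (hconv : Convex ℝ {v : V | ψ v = 1 ∧ ∃ hv : v ≠ 0, Projectivization.mk ℝ v hv ∈ Ω})
    {g : SL(3, ℝ)} (hg : ∀ p ∈ Ω, g • p ∈ Ω) :
    ∃ ε : ℝ, (ε = 1 ∨ ε = -1) ∧ ∀ v ∈ coneOver Ω ψ, ε • g • v ∈ coneOver Ω ψ := by
  have hmem : ∀ v ∈ coneOver Ω ψ, ∃ h : g • v ≠ 0, Projectivization.mk ℝ (g • v) h ∈ Ω := by
    rintro v ⟨-, h0, h1⟩
    have := hg _ h1
    rw [Projectivization.smul_mk] at this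
    exact ⟨_, this⟩
  have hne : ∀ v ∈ coneOver Ω ψ, ψ (g • v) ≠ 0 := fun v hv => by
    obtain ⟨h0, h1⟩ := hmem v hv
    exact chart_ne_zero hψ h0 h1
  by_cases hpos : ∀ v ∈ coneOver Ω ψ, 0 < ψ (g • v)
  · refine ⟨1, Or.inl rfl, fun v hv => ?_⟩
    rw [one_smul]
    exact ⟨hpos v hv, hmem v hv⟩
  · push Not at hpos
    obtain ⟨w, hw, hw0⟩ := hpos
    have hw1 : ψ (g • w) < 0 := lt_of_le_of_ne hw0 (hne w hw)
    refine ⟨-1, Or.inr rfl, fun v hv => ?_⟩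
    have hneg : ψ (g • v) < 0 := by
      refine lt_of_le_of_ne ?_ (hne v hv)
      by_contra! hv0
      -- If ψ ∘ g took both signs, this positive combination of v and w would be a zero of ψ ∘ g in
      -- the cone.
      refine hne _ (coneOver.add_mem hconv (coneOver.smul_mem hv (neg_pos.2 hw1))
        (coneOver.smul_mem hw hv0)) ?_
      rw [smul_add, smul_comm g, smul_comm g (ψ (g • v)), map_add, map_smul (M := ℝ),
        map_smul (M := ℝ), smul_eq_mul, smul_eq_mul]
      ring
    obtain ⟨h0, h1⟩ := hmem v hv
    have h2 : (-1 : ℝ) • g • v ≠ 0 := smul_ne_zero (by norm_num) h0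
    refine ⟨?_, h2, ?_⟩
    · rw [map_smul, smul_eq_mul]
      linarith
    · rwa [mk_smul_eq h0]

end coneOver

namespace ConvexProjectiveStructure

variable (π : ConvexProjectiveStructure)

/-- Boundary points have supporting functionals, which are positive on the other boundary
components. -/
theorem exists_support {ψ : V →ₗ[ℝ] ℝ}
    (hconv : Convex ℝ {v : V | ψ v = 1 ∧ ∃ hv : v ≠ 0, Projectivization.mk ℝ v hv ∈ Set.range π.dev})
    {x : Cover} (hx : x ∈ Cover.boundary) {v : V} (hv : v ∈ coneOver (Set.range π.dev) ψ)
    (hv0 : v ≠ 0) (hvx : Projectivization.mk ℝ v hv0 = π.dev x) :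
    ∃ φ : V →ₗ[ℝ] ℝ, φ v = 0 ∧ (∀ w ∈ coneOver (Set.range π.dev) ψ, 0 ≤ φ w) ∧
      ∀ w ∈ coneOver (Set.range π.dev) ψ, ∀ hw0 : w ≠ 0, ∀ y : Cover,
        Projectivization.mk ℝ w hw0 = π.dev y → φ w = 0 →
        ∀ g : SL(2, ℤ), (g • x.1).im = 2 → (g • y.1).im = 2 := by
  obtain ⟨N, φ, χ, hN, hxN, hφ, hχ, hrange, hbdry⟩ := π.boundary_straight x hx
  have hφv : φ v = 0 := by
    have h := (hbdry x hxN).1 hx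
    rw [← hvx] at h
    obtain ⟨a, ha0, ha⟩ := exists_rep_eq_smul v hv0
    rw [ha, map_smul, smul_eq_mul] at h
    exact (mul_eq_zero.1 h).resolve_left ha0
  have hχv : χ v ≠ 0 := by
    intro h0
    obtain ⟨a, -, ha⟩ := exists_rep_eq_smul v hv0
    refine hχ _ hxN ?_
    rw [← hvx, ha, map_smul, h0, smul_zero]
  -- For small t > 0, v + t w represents a point of the domain in N, where φ / χ ≥ 0. Since φ v = 0,
  -- clearing the denominator and letting t → 0 gives the sign; the supporting functional is thus
  -- χ(v) φ.
  have hnonneg : ∀ w ∈ coneOver (Set.range π.dev) ψ, 0 ≤ χ v * φ w := by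
    intro w hw
    have hpath : Tendsto (fun t : ℝ => v + t • w) (𝓝[>] 0) (𝓝 v) := by
      have : Continuous fun t : ℝ => v + t • w := by fun_prop
      have h := this.tendsto 0
      rw [zero_smul, add_zero] at h
      exact h.mono_left nhdsWithin_le_nhds
    have hev : ∀ᶠ t in 𝓝[>] (0 : ℝ), 0 ≤ χ (v + t • w) * φ w := by
      have h1 := hpath.eventually ((isOpen_lift hN).mem_nhds ⟨hv0, hvx ▸ hxN⟩)
      filter_upwards [h1, self_mem_nhdsWithin] with t ⟨ht0, htN⟩ htpos
      have htK := coneOver.add_mem hconv hv (coneOver.smul_mem hw htpos)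
      obtain ⟨_, _, hmem⟩ := htK
      have h2 := (hrange _ htN).1 hmem
      obtain ⟨a, ha0, ha⟩ := exists_rep_eq_smul _ ht0
      rw [ha, map_smul, map_smul, smul_eq_mul, smul_eq_mul, mul_div_mul_left _ _ ha0, map_add,
        hφv, zero_add, map_smul, smul_eq_mul] at h2
      have h3 := mul_nonneg h2 (sq_nonneg (χ (v + t • w)))
      have htpos' : 0 < t := htpos
      by_cases hz : χ (v + t • w) = 0
      · rw [hz, zero_mul]
      · have h4 : t * φ w / χ (v + t • w) * χ (v + t • w) ^ 2 = t * (χ (v + t • w) * φ w) := by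
          field_simp
        rw [h4] at h3
        exact nonneg_of_mul_nonneg_right h3 htpos'
    have hlim : Tendsto (fun t : ℝ => χ (v + t • w) * φ w) (𝓝[>] 0) (𝓝 (χ v * φ w)) :=
      (((χ.continuous_of_finiteDimensional.tendsto v).comp hpath).mul_const _)
    exact ge_of_tendsto hlim hev
  refine ⟨χ v • φ, by simp [hφv], fun w hw => by simpa using hnonneg w hw, ?_⟩
  intro w hw hw0 y hwy hφw g hg
  have hφw' : φ w = 0 := by
    simpa [hχv] using hφw
  -- If φ w = 0, the segment from v to w lies in the kernel of φ. Its pullback by the embedding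
  -- `π.dev` is a path that must stay in the boundary, hence on one horocycle.
  have hseg : ∀ t : unitInterval, (1 - t.1) • v + t.1 • w ∈ coneOver (Set.range π.dev) ψ := by
    rintro ⟨t, ht0, ht1⟩
    rcases ht0.eq_or_lt with rfl | ht0
    · simpa using hv
    rcases ht1.eq_or_lt with rfl | ht1
    · simpa using hw
    exact coneOver.add_mem hconv (coneOver.smul_mem hv (sub_pos.2 ht1)) (coneOver.smul_mem hw ht0)
  have hne : ∀ t : unitInterval, (1 - t.1) • v + t.1 • w ≠ 0 := fun t => (hseg t).2.1
  have hex : ∀ t : unitInterval, ∃ z : Cover,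
      π.dev z = Projectivization.mk ℝ ((1 - t.1) • v + t.1 • w) (hne t) := fun t => (hseg t).2.2
  choose γ hγ using hex
  have hγc : Continuous γ := by
    rw [π.isEmbedding.continuous_iff]
    have : π.dev ∘ γ = (fun v : {v : V // v ≠ 0} => Projectivization.mk ℝ v.1 v.2) ∘
        fun t : unitInterval => ⟨(1 - t.1) • v + t.1 • w, hne t⟩ := funext hγ
    rw [this]
    exact continuous_mk.comp (Continuous.subtype_mk (by fun_prop) _)
  have hγ0 : γ 0 = x := by
    apply π.isEmbedding.injective
    rw [hγ, ← hvx]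
    congr 1
    simp
  have hγ1 : γ 1 = y := by
    apply π.isEmbedding.injective
    rw [hγ, ← hwy]
    congr 1
    simp
  rw [← hγ1]
  refine Cover.im_smul_eq_two_of_path hγc (fun t => ?_) (by rwa [hγ0])
  by_contra hint
  have hopen := isOpen_lift (π.isOpen_image _ Cover.isClosed_boundary.isOpen_compl
    disjoint_compl_left)
  -- At an interior point of the path the image is open, so a small push along e would stay in the
  -- cone with a negative value of χ(v) φ.
  obtain ⟨e, he⟩ : ∃ e, χ v * φ e < 0 := by
    obtain ⟨e, he⟩ : ∃ e, φ e ≠ 0 := by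
      by_contra! h
      exact hφ (LinearMap.ext h)
    refine ⟨(-(χ v * φ e)) • e, ?_⟩
    rw [map_smul, smul_eq_mul]
    have : 0 < (χ v * φ e) ^ 2 := by positivity
    nlinarith
  have hpath : Tendsto (fun s : ℝ => ((1 - t.1) • v + t.1 • w) + s • e) (𝓝[>] 0)
      (𝓝 ((1 - t.1) • v + t.1 • w)) := by
    have : Continuous fun s : ℝ => ((1 - t.1) • v + t.1 • w) + s • e := by fun_prop
    have h := this.tendsto 0
    rw [zero_smul, add_zero] at h
    exact h.mono_left nhdsWithin_le_nhds
  have h1 := hpath.eventually (hopen.mem_nhds ⟨hne t, γ t, hint, hγ t⟩)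
  have h2 := hpath.eventually
    ((isOpen_lt continuous_const ψ.continuous_of_finiteDimensional).mem_nhds (hseg t).1)
  have hpos : ∀ᶠ s in 𝓝[>] (0 : ℝ), 0 < s := self_mem_nhdsWithin
  obtain ⟨s, ⟨⟨hs0, z, -, hz⟩, hs2⟩, hs⟩ := ((h1.and h2).and hpos).exists
  have h3 := hnonneg _ ⟨hs2, hs0, z, hz⟩
  rw [map_add, map_add, map_smul, map_smul, hφv, hφw', map_smul] at h3
  simp only [smul_eq_mul, mul_zero, add_zero, zero_add] at h3
  nlinarith

end ConvexProjectiveStructure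

/-! ### The invariant cone and positivity of the peripheral flags -/

/-- A point on the horocycle around `pᵢ`. -/
noncomputable def horocyclePoint (i : Fin 3) : ℍ :=
  (toInfinity i)⁻¹ • (⟨2 * Complex.I, by simp⟩ : ℍ)

theorem im_smul_horocyclePoint (i : Fin 3) (g : SL(2, ℤ)) :
    ((g * (toInfinity i)⁻¹) 1 0 = 0 → (g • horocyclePoint i).im = 2) ∧
      ((g * (toInfinity i)⁻¹) 1 0 ≠ 0 → (g • horocyclePoint i).im ≤ 1 / 2) := by
  rw [horocyclePoint, smul_smul]
  have h2 : (⟨2 * Complex.I, by simp⟩ : ℍ).im = 2 := by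
    rw [← UpperHalfPlane.coe_im]
    simp
  constructor
  · intro h
    rw [im_smul_of_zero _ _ h, h2]
  · intro h
    have := im_smul_le _ (⟨2 * Complex.I, by simp⟩ : ℍ) h
    rwa [h2] at this

/-- A boundary point of the universal cover on the horocycle around `pᵢ`. -/
noncomputable def boundaryPoint (i : Fin 3) : Cover :=
  ⟨horocyclePoint i, fun g => by
    by_cases h : (g * (toInfinity i)⁻¹) 1 0 = 0
    · exact ((im_smul_horocyclePoint i g).1 h).le
    · have := (im_smul_horocyclePoint i g).2 h
      linarith⟩

theorem im_toInfinity_boundaryPoint (i : Fin 3) : (toInfinity i • (boundaryPoint i).1).im = 2 :=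
  (im_smul_horocyclePoint i _).1 (by rw [mul_inv_cancel]; rfl)

theorem im_toInfinity_boundaryPoint_ne {i j : Fin 3} (h : i ≠ j) :
    (toInfinity i • (boundaryPoint j).1).im ≠ 2 := by
  have hc : (toInfinity i * (toInfinity j)⁻¹) 1 0 ≠ 0 := by
    fin_cases i <;> fin_cases j <;> first | exact absurd rfl h | decide
  have := (im_smul_horocyclePoint j _).2 hc
  intro h2
  have h3 : (toInfinity i • horocyclePoint j).im = 2 := h2
  linarith

namespace ConvexProjectiveStructure

variable (π : ConvexProjectiveStructure)

/-- The cone of a convex projective structure: it is sharp, contains representatives of the points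
of the image of the developing map, and is preserved up to sign by the monodromy. -/
theorem exists_cone : ∃ C : Set V, IsSharpCone C ∧
    ∀ g : Deck, ∃ ε : ℝ, (ε = 1 ∨ ε = -1) ∧ ∀ v ∈ C, ε • π.rho g • v ∈ C := by
  obtain ⟨ψ, hψ, hconv⟩ := π.convex
  set K := coneOver (Set.range π.dev) ψ with hK
  choose v hvK hv0 hvx using fun i : Fin 3 =>
    exists_mem_coneOver hψ (Set.mem_range_self (f := π.dev) (boundaryPoint i))
  choose φ hφv hφK hφne using fun i : Fin 3 =>
    π.exists_support hconv ⟨_, im_toInfinity_boundaryPoint i⟩ (hvK i) (hv0 i) (hvx i)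
  have hpos : ∀ i j, i ≠ j → 0 < φ i (v j) := by
    intro i j hij
    refine lt_of_le_of_ne (hφK i _ (hvK j)) fun h0 => ?_
    exact im_toInfinity_boundaryPoint_ne hij (hφne i _ (hvK j) (hv0 j) _ (hvx j) h0.symm _
      (im_toInfinity_boundaryPoint i))
  have hφC : ∀ i, ∀ w ∈ closure K, 0 ≤ φ i w := by
    intro i
    exact closure_minimal (hφK i)
      (isClosed_le continuous_const (φ i).continuous_of_finiteDimensional)
  have hadd : ∀ x ∈ closure K, ∀ y ∈ closure K, x + y ∈ closure K := fun x hx y hy =>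
    map_mem_closure₂ continuous_add hx hy fun a ha b hb => coneOver.add_mem hconv ha hb
  have hsmul : ∀ a : ℝ, 0 < a → ∀ x ∈ closure K, a • x ∈ closure K := fun a ha x hx =>
    map_mem_closure (continuous_const_smul a) hx fun b hb => coneOver.smul_mem hb ha
  refine ⟨closure K, ⟨isClosed_closure, hadd, ?_, ⟨∑ i, φ i, ?_⟩, ?_⟩, ?_⟩
  · intro a ha x hx
    rcases ha.eq_or_lt with rfl | ha
    · have hlim : Tendsto (fun t : ℝ => t • x) (𝓝[>] 0) (𝓝 ((0 : ℝ) • x)) :=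
        ((continuous_id.smul continuous_const).tendsto (0 : ℝ)).mono_left nhdsWithin_le_nhds
      refine isClosed_closure.mem_of_tendsto hlim ?_
      filter_upwards [self_mem_nhdsWithin] with t ht using hsmul t ht x hx
    · exact hsmul a ha x hx
  -- The φᵢ are nonnegative on the closed cone and independent, so their sum vanishes there only at
  -- 0.
  · intro w hw hw0
    have hnn := fun i => hφC i w hw
    rw [LinearMap.sum_apply]
    refine lt_of_le_of_ne (Finset.sum_nonneg fun i _ => hnn i) fun h => hw0 ?_
    have h1 := (Finset.sum_eq_zero_iff_of_nonneg fun i _ => hnn i).1 h.symm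
    exact eq_zero_of_support hφv hpos fun i => h1 i (Finset.mem_univ i)
  · intro f hf
    exact functional_eq_zero_of_support hφv hpos fun i => hf _ (subset_closure (hvK i))
  · intro g
    obtain ⟨ε, hε, h⟩ := exists_sign hψ hconv (g := π.rho g) (by
      rintro _ ⟨x, rfl⟩
      exact ⟨Deck.act g x, π.equivariant g x⟩)
    refine ⟨ε, hε, fun w hw => ?_⟩
    have hcont : Continuous fun w : V => ε • π.rho g • w :=
      ((ε • act (π.rho g) : V →ₗ[ℝ] V)).continuous_of_finiteDimensional
    exact map_mem_closure (f := fun w : V => ε • π.rho g • w) hcont hw h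

/-- A common eigenvector would make the monodromy of Aᵢⁿ[Aᵢ, Aⱼ]Aᵢ⁻ⁿ contract to the identity. As
`π.dev` is an embedding, the deck transformations would then bring any point back to itself in the
limit. -/
theorem not_eigenvector {C : Set V} (hC : IsSharpCone C) {i j : Fin 3} (hij : i ≠ j)
    {r r' : Fin 3 → ℝ} (E : EigenFrame C (π.rho (peripheral i)) r)
    (E' : EigenFrame C (π.rho (peripheral j)) r') :
    ¬ ∃ a : ℝ, π.rho (peripheral j) • E.b 0 = a • E.b 0 := by
  rintro ⟨a, ha⟩
  refine not_tendsto_act_conj_commutator hij (boundaryPoint 0) ?_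
  rw [π.isEmbedding.tendsto_nhds_iff]
  set v := (π.dev (boundaryPoint 0)).rep with hv
  have hv0 : v ≠ 0 := Projectivization.rep_nonzero _
  have hvx : π.dev (boundaryPoint 0) = Projectivization.mk ℝ v hv0 :=
    (Projectivization.mk_rep _).symm
  have hlim := E.tendsto_conj_commutator hC E'.map_mem E'.map_inv_mem ha v
  rw [hvx]
  simp only [Function.comp_def, π.equivariant, hvx, Projectivization.smul_mk]
  have h1 : Tendsto (fun n : ℕ => (⟨_, (smul_ne_zero_iff_ne (π.rho (peripheral i ^ n *
      (peripheral i * peripheral j * (peripheral i)⁻¹ * (peripheral j)⁻¹) *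
      (peripheral i ^ n)⁻¹))).mpr hv0⟩ : {v : V // v ≠ 0})) atTop (𝓝 ⟨v, hv0⟩) := by
    rw [tendsto_subtype_rng]
    simpa only [map_mul, map_pow, map_inv] using hlim
  exact (continuous_mk.tendsto _).comp h1

/-- The eigenframes of the peripheral elements. -/
theorem exists_eigenFrames : ∃ (C : Set V) (_ : IsSharpCone C)
    (E : ∀ i, EigenFrame C (π.rho (peripheral i))
      ![(π.hyperbolic i).lam, (π.hyperbolic i).mu, (π.hyperbolic i).nu]),
    ∀ i j, i ≠ j → 0 < (E i).b.repr ((E j).b 0) 2 := by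
  obtain ⟨C, hC, hinv⟩ := π.exists_cone
  have hE : ∀ i, Nonempty (EigenFrame C (π.rho (peripheral i))
      ![(π.hyperbolic i).lam, (π.hyperbolic i).mu, (π.hyperbolic i).nu]) := by
    intro i
    obtain ⟨ε, hε, h⟩ := hinv (peripheral i)
    obtain ⟨δ, hδ, h'⟩ := hinv (peripheral i)⁻¹
    rw [map_inv] at h'
    exact hC.exists_eigenFrame (π.hyperbolic i).hasSpectrum hε h hδ h'
  let E := fun i => (hE i).some
  exact ⟨C, hC, E, fun i j hij => EigenFrame.repr_two_pos hC (E i) (E j)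
    (π.not_eigenvector hC hij (E i) (E j)) (π.not_eigenvector hC hij.symm (E j) (E i))⟩

end ConvexProjectiveStructure

/-! ### Wedge products in eigenbases -/

theorem wedge3_smul (g : SL(3, ℝ)) (x y z : V) :
    wedge3 (g • x) (g • y) (g • z) = wedge3 x y z := by
  have h : Matrix.of ![g • x, g • y, g • z] = Matrix.of ![x, y, z] * g.1.transpose := by
    ext i j
    have hrow : ∀ v : V, (g • v) j = ∑ k, v k * g.1.transpose k j := fun v => by
      change ∑ k, g.1 j k * v k = _
      exact Finset.sum_congr rfl fun k _ => mul_comm _ _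
    rw [Matrix.mul_apply]
    fin_cases i
    · exact hrow x
    · exact hrow y
    · exact hrow z
  rw [wedge3, h, Matrix.det_mul, Matrix.det_transpose, g.2, mul_one, wedge3]

theorem wedge3_smul_right (g : SL(3, ℝ)) (x y z : V) :
    wedge3 x y (g • z) = wedge3 (g⁻¹ • x) (g⁻¹ • y) z := by
  rw [← wedge3_smul g (g⁻¹ • x), smul_inv_smul, smul_inv_smul]

theorem wedge3_smul_smul_smul (a b c : ℝ) (x y z : V) :
    wedge3 (a • x) (b • y) (c • z) = a * b * c * wedge3 x y z := by
  simp only [wedge3, Matrix.det_fin_three, Matrix.of_apply, Matrix.cons_val, Pi.smul_apply, smul_eq_mul]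
  ring

theorem wedge3_rotate (x y z : V) : wedge3 x y z = wedge3 y z x := by
  simp only [wedge3, Matrix.det_fin_three, Matrix.of_apply, Matrix.cons_val]
  ring

theorem wedge3_triangular (s p q x y z : ℝ) (a b c : V) :
    wedge3 (s • a) (p • a + q • b) (x • a + y • b + z • c) = s * q * z * wedge3 a b c := by
  simp only [wedge3, Matrix.det_fin_three, Matrix.of_apply, Matrix.cons_val, Pi.smul_apply, Pi.add_apply,
    smul_eq_mul]
  ring

theorem wedge3_basis_ne_zero (b : Module.Basis (Fin 3) ℝ V) : wedge3 (b 0) (b 1) (b 2) ≠ 0 := by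
  have h : LinearIndependent ℝ (Matrix.of ![b 0, b 1, b 2]).row := by
    convert b.linearIndependent using 1
    ext i
    fin_cases i <;> rfl
  rw [Matrix.linearIndependent_rows_iff_isUnit, Matrix.isUnit_iff_isUnit_det] at h
  exact h.ne_zero

theorem mem_eigenspace_iff {M : SL(3, ℝ)} {x : ℝ} {v : V} :
    v ∈ eigenspace M x ↔ M • v = x • v :=
  Module.End.mem_eigenspace_iff

namespace EigenFrame

variable {C : Set V} {M : SL(3, ℝ)} {r : Fin 3 → ℝ} (E : EigenFrame C M r)
include E

theorem injective_eigenvalue {i j : Fin 3} (h : r i = r j) : i = j := by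
  have h1 := E.lt₁
  have h2 := E.lt₂
  fin_cases i <;> fin_cases j <;> first | rfl | (exfalso; simp at h; linarith)

theorem repr_of_mem_eigenspace {i j : Fin 3} (hij : i ≠ j) {v : V} (hv : v ∈ eigenspace M (r i)) :
    E.b.repr v j = 0 := by
  rw [mem_eigenspace_iff] at hv
  have h := E.repr_smul_self v j
  rw [hv, map_smul, Finsupp.smul_apply, smul_eq_mul] at h
  have : (r i - r j) * E.b.repr v j = 0 := by linarith
  exact (mul_eq_zero.1 this).resolve_left
    (sub_ne_zero.2 fun h => hij (E.injective_eigenvalue h))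

/-- Exterior powers of the unstable flag in terms of an eigenbasis. -/
theorem exists_scalars {u w : V} (hu : u ∈ eigenspace M (r 0))
    (hw : w ∈ eigenspace M (r 0) ⊔ eigenspace M (r 1)) (hli : LinearIndependent ℝ ![u, w]) :
    ∃ s κ : ℝ, s ≠ 0 ∧ κ ≠ 0 ∧ u = s • E.b 0 ∧ ∀ x, wedge3 u w x = κ * E.b.repr x 2 := by
  have hu' : u = E.b.repr u 0 • E.b 0 := by
    conv_lhs => rw [← E.b.sum_repr u, Fin.sum_univ_three,
      E.repr_of_mem_eigenspace (i := 0) (j := 1) (by decide) hu,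
      E.repr_of_mem_eigenspace (i := 0) (j := 2) (by decide) hu]
    simp
  have hw2 : E.b.repr w 2 = 0 := by
    obtain ⟨y, hy, z, hz, rfl⟩ := Submodule.mem_sup.1 hw
    rw [map_add, Finsupp.add_apply, E.repr_of_mem_eigenspace (i := 0) (j := 2) (by decide) hy,
      E.repr_of_mem_eigenspace (i := 1) (j := 2) (by decide) hz, add_zero]
  have hw' : w = E.b.repr w 0 • E.b 0 + E.b.repr w 1 • E.b 1 := by
    conv_lhs => rw [← E.b.sum_repr w, Fin.sum_univ_three, hw2, zero_smul, add_zero]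
  have hs : E.b.repr u 0 ≠ 0 := by
    intro h
    rw [h, zero_smul] at hu'
    exact hli.ne_zero 0 hu'
  have hq : E.b.repr w 1 ≠ 0 := by
    intro h
    rw [h, zero_smul, add_zero] at hw'
    rw [LinearIndependent.pair_iff] at hli
    refine hs (neg_eq_zero.1 (hli (E.b.repr w 0) (-E.b.repr u 0) ?_).2)
    rw [hu', hw']
    simp only [map_smul, Module.Basis.repr_self, Finsupp.smul_apply, Finsupp.single_eq_same]
    module
  refine ⟨_, E.b.repr u 0 * E.b.repr w 1 * wedge3 (E.b 0) (E.b 1) (E.b 2), hs,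
    mul_ne_zero (mul_ne_zero hs hq) (wedge3_basis_ne_zero _), hu', fun x => ?_⟩
  have hx := E.b.sum_repr x
  rw [Fin.sum_univ_three] at hx
  conv_lhs => rw [hu', hw', ← hx]
  rw [wedge3_triangular]
  ring

/-- The spectrum of a conjugate. -/
theorem conj_spectrum {g : SL(3, ℝ)} {l m n : ℝ} (h : HasSpectrum (g * M * g⁻¹) l m n) :
    l = r 0 ∧ m = r 1 ∧ n = r 2 := by
  have key : ∀ x, IsEigenvalue (g * M * g⁻¹) x → x = r 0 ∨ x = r 1 ∨ x = r 2 := by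
    intro x hx
    obtain ⟨v, hv, hv0⟩ := Module.End.HasEigenvalue.exists_hasEigenvector hx
    have hv' : (g * M * g⁻¹) • v = x • v := mem_eigenspace_iff.1 hv
    have hM : M • g⁻¹ • v = x • g⁻¹ • v := by
      rw [← smul_comm g⁻¹ x v, ← hv', mul_smul, mul_smul, inv_smul_smul]
    obtain ⟨i, hi⟩ : ∃ i, E.b.repr (g⁻¹ • v) i ≠ 0 := by
      by_contra! h0
      refine (smul_ne_zero_iff_ne g⁻¹).2 hv0 (E.b.repr.map_eq_zero_iff.1 ?_)
      ext i
      exact h0 i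
    have hxi : x = r i := by
      refine mul_right_cancel₀ hi ?_
      rw [← E.repr_smul_self, hM, LinearEquiv.map_smul, Finsupp.smul_apply, smul_eq_mul]
    fin_cases i
    · exact Or.inl hxi
    · exact Or.inr (Or.inl hxi)
    · exact Or.inr (Or.inr hxi)
  have h1 := h.lt₁
  have h2 := h.lt₂
  have e1 := E.lt₁
  have e2 := E.lt₂
  -- Both triples are strictly increasing, so every matching other than the identity is
  -- contradictory.
  rcases key l h.eig₁ with hl | hl | hl <;> rcases key m h.eig₂ with hm | hm | hm <;>
    rcases key n h.eig₃ with hn | hn | hn <;> exact ⟨by linarith, by linarith, by linarith⟩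

end EigenFrame

/-! ### The relation of the pair of pants and the flags at the vertices -/

theorem peripheral_relation (i : Fin 3) :
    peripheral (i - 1) * peripheral (i + 1) * peripheral i = Deck.negOne := by
  apply Subtype.ext
  fin_cases i <;> decide

/-- The arithmetic of indices modulo `3`. -/
theorem index_arith (i : Fin 3) : i + 1 + 1 = i - 1 ∧ i + 1 - 1 = i ∧ i - 1 + 1 = i ∧
    i - 1 - 1 = i + 1 ∧ i + 1 ≠ i ∧ i - 1 ≠ i ∧ i + 1 ≠ i - 1 := by
  fin_cases i <;> decide

namespace ConvexProjectiveStructure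

variable (π : ConvexProjectiveStructure)

/-- The monodromy of `Aᵢ`. -/
noncomputable abbrev mon (i : Fin 3) : SL(3, ℝ) := π.rho (peripheral i)

noncomputable abbrev mu (i : Fin 3) : ℝ := (π.hyperbolic i).mu

noncomputable abbrev nu (i : Fin 3) : ℝ := (π.hyperbolic i).nu

theorem mon_relation (i : Fin 3) (v : V) :
    π.mon (i - 1) • π.mon (i + 1) • π.mon i • v = v := by
  have h := congrArg π.rho (peripheral_relation i)
  rw [π.rho_negOne, map_mul, map_mul] at h
  rw [smul_smul, smul_smul, h, one_smul]

theorem mon_succ_inv (i : Fin 3) (v : V) :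
    (π.mon (i + 1))⁻¹ • v = π.mon i • π.mon (i - 1) • v := by
  rw [inv_smul_eq_iff]
  have h := π.mon_relation i (π.mon (i - 1) • v)
  exact (smul_left_cancel _ h).symm

/-- A positive configuration of eigenframes for the peripheral elements. -/
structure EigenSystem where
  C : Set V
  E : ∀ i, EigenFrame C (π.mon i) ![π.lam i, π.mu i, π.nu i]
  pos : ∀ i j, i ≠ j → 0 < (E i).b.repr ((E j).b 0) 2

instance : Nonempty π.EigenSystem := by
  obtain ⟨C, -, E, h⟩ := π.exists_eigenFrames
  exact ⟨⟨C, E, h⟩⟩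

namespace EigenSystem

variable {π} (S : π.EigenSystem)

/-- The vector spanning the line of the flag `Fᵢ`. -/
noncomputable def e (i : Fin 3) : V := (S.E i).b 0

/-- The functional whose kernel is the plane of the flag `Fᵢ`. -/
noncomputable def q (i : Fin 3) : V →ₗ[ℝ] ℝ := (S.E i).b.coord 2

include S in
theorem lam_pos (i : Fin 3) : 0 < π.lam i := (S.E i).pos 0

include S in
theorem mu_pos (i : Fin 3) : 0 < π.mu i := (S.E i).pos 1

include S in
theorem nu_pos (i : Fin 3) : 0 < π.nu i := (S.E i).pos 2

theorem q_e_self (i : Fin 3) : S.q i (S.e i) = 0 := by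
  simp [q, e]

theorem q_e_pos {i j : Fin 3} (h : i ≠ j) : 0 < S.q i (S.e j) := S.pos i j h

theorem mon_e (i : Fin 3) : π.mon i • S.e i = π.lam i • S.e i := (S.E i).eig 0

theorem mon_inv_e (i : Fin 3) : (π.mon i)⁻¹ • S.e i = (π.lam i)⁻¹ • S.e i :=
  inv_smul_eig (S.lam_pos i).ne' (S.mon_e i)

theorem q_mon (i : Fin 3) (v : V) : S.q i (π.mon i • v) = π.nu i * S.q i v :=
  (S.E i).repr_smul_self v 2

theorem q_mon_inv (i : Fin 3) (v : V) : S.q i ((π.mon i)⁻¹ • v) = (π.nu i)⁻¹ * S.q i v :=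
  (S.E i).repr_inv_smul_self v 2

include S in
theorem lam_mul_mu_mul_nu (i : Fin 3) : π.lam i * π.mu i * π.nu i = 1 := by
  have h := det_matrixIn (S.E i).b (π.mon i)
  rw [(S.E i).matrixIn_self, Matrix.det_diagonal, Fin.prod_univ_three] at h
  exact h

/-- The vertex pᵢ' is both Aᵢ₊₁ pᵢ and Aᵢ₋₁⁻¹ pᵢ, so the two images of eᵢ are proportional. This
makes qᵢ₋₁ computable on the line of Fᵢ'. -/
theorem mon_succ_e (i : Fin 3) :
    π.mon (i + 1) • S.e i = (π.lam i)⁻¹ • (π.mon (i - 1))⁻¹ • S.e i := by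
  have h := π.mon_relation i ((π.mon i)⁻¹ • S.e i)
  rw [smul_inv_smul] at h
  rw [← smul_comm (π.mon (i - 1))⁻¹, ← S.mon_inv_e, eq_inv_smul_iff]
  exact h

theorem q_pred_mon_succ_e (i : Fin 3) :
    S.q (i - 1) (π.mon (i + 1) • S.e i) =
      (π.lam i)⁻¹ * ((π.nu (i - 1))⁻¹ * S.q (i - 1) (S.e i)) := by
  rw [S.mon_succ_e, LinearMap.map_smul, S.q_mon_inv, smul_eq_mul]

theorem wedge_e_ne_zero (i : Fin 3) : wedge3 (S.e (i + 1)) (S.e (i - 1)) (S.e i) ≠ 0 := by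
  obtain ⟨-, -, -, -, h1, h2, h3⟩ := index_arith i
  refine (det_ne_zero_of_support (φ := ![S.q (i + 1), S.q (i - 1), S.q i]) (x := ![S.e (i + 1), S.e (i - 1), S.e i]) ?_ ?_).2
  · intro j
    fin_cases j <;> exact S.q_e_self _
  · intro j k hjk
    fin_cases j <;> fin_cases k <;> first | exact absurd rfl hjk | skip
    · exact S.q_e_pos h3
    · exact S.q_e_pos h1
    · exact S.q_e_pos h3.symm
    · exact S.q_e_pos h2
    · exact S.q_e_pos h1.symm
    · exact S.q_e_pos h2.symm

/-- The plane of Fᵢ' is the kernel of qᵢ ∘ Aᵢ₊₁⁻¹. With this third functional, the pants relation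
reduces all six positivity conditions to those for F₁, F₂, F₃. -/
theorem wedge_e_mon_ne_zero (i : Fin 3) :
    wedge3 (S.e (i + 1)) (S.e (i - 1)) (π.mon (i + 1) • S.e i) ≠ 0 := by
  obtain ⟨-, -, -, -, h1, h2, h3⟩ := index_arith i
  refine (det_ne_zero_of_support
    (φ := ![S.q (i + 1), S.q (i - 1), (S.q i).comp (act (π.mon (i + 1))⁻¹)])
    (x := ![S.e (i + 1), S.e (i - 1), π.mon (i + 1) • S.e i]) ?_ ?_).2
  · intro j
    fin_cases j
    · exact S.q_e_self _
    · exact S.q_e_self _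
    · change S.q i ((π.mon (i + 1))⁻¹ • π.mon (i + 1) • S.e i) = 0
      rw [inv_smul_smul, S.q_e_self]
  · intro j k hjk
    fin_cases j <;> fin_cases k <;> first | exact absurd rfl hjk | skip
    · exact S.q_e_pos h3
    · change 0 < S.q (i + 1) (π.mon (i + 1) • S.e i)
      rw [S.q_mon]
      exact mul_pos (S.nu_pos _) (S.q_e_pos h1)
    · exact S.q_e_pos h3.symm
    · change 0 < S.q (i - 1) (π.mon (i + 1) • S.e i)
      rw [S.q_pred_mon_succ_e]
      exact mul_pos (inv_pos.2 (S.lam_pos _))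
        (mul_pos (inv_pos.2 (S.nu_pos _)) (S.q_e_pos h2))
    · change 0 < S.q i ((π.mon (i + 1))⁻¹ • S.e (i + 1))
      rw [S.mon_inv_e, LinearMap.map_smul]
      exact mul_pos (inv_pos.2 (S.lam_pos _)) (S.q_e_pos h1.symm)
    · change 0 < S.q i ((π.mon (i + 1))⁻¹ • S.e (i - 1))
      rw [π.mon_succ_inv, S.q_mon, S.mon_e, LinearMap.map_smul]
      exact mul_pos (S.nu_pos _) (mul_pos (S.lam_pos _) (S.q_e_pos h2.symm))

/-- The triangles (pᵢ₋₁, pᵢ, pᵢ₊₁') and (pᵢ, pᵢ₊₁, pᵢ₋₁') are lifts of T₋ related by Aᵢ, which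
preserves volume. The factors record how it rescales the chosen vectors. -/
theorem wedge_mon_relation (i : Fin 3) :
    π.lam i * wedge3 (S.e i) (S.e (i + 1)) (π.mon i • S.e (i - 1)) =
      π.lam (i + 1) * wedge3 (S.e (i - 1)) (S.e i) (π.mon (i - 1) • S.e (i + 1)) := by
  obtain ⟨h1, h2, -⟩ := index_arith i
  have h := S.mon_succ_e (i + 1)
  rw [h1, h2] at h
  have hl := (S.lam_pos i).ne'
  have hl' := (S.lam_pos (i + 1)).ne'
  rw [h, wedge3_smul_right, S.mon_inv_e, wedge3_rotate (S.e (i - 1))]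
  have e1 := wedge3_smul_smul_smul (π.lam i)⁻¹ 1 1 (S.e i) ((π.mon i)⁻¹ • S.e (i + 1)) (S.e (i - 1))
  have e2 := wedge3_smul_smul_smul 1 (π.lam (i + 1))⁻¹ 1 (S.e i) ((π.mon i)⁻¹ • S.e (i + 1))
    (S.e (i - 1))
  simp only [one_smul] at e1 e2
  rw [e1, e2]
  field_simp

/-- The elements of the exterior powers of the flags, in terms of the eigensystem. -/
theorem exists_frame_scalars {i : Fin 3} (f : Frame (π.flag i)) :
    ∃ s κ : ℝ, s ≠ 0 ∧ κ ≠ 0 ∧ f.u = s • S.e i ∧ ∀ x, wedge3 f.u f.w x = κ * S.q i x :=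
  (S.E i).exists_scalars f.u_mem f.w_mem f.indep

theorem exists_frame'_scalars {i : Fin 3} (f : Frame (π.flag' i)) :
    ∃ s κ : ℝ, s ≠ 0 ∧ κ ≠ 0 ∧ f.u = s • π.mon (i + 1) • S.e i ∧
      ∀ x, wedge3 f.u f.w x = κ * S.q i ((π.mon (i + 1))⁻¹ • x) := by
  have hrho : π.rho (peripheral' i) = π.mon (i + 1) * π.mon i * (π.mon (i + 1))⁻¹ := by
    rw [peripheral', map_mul, map_mul, map_inv]
  -- The eigenvalues defining Fᵢ' come from a separate choice and must first be identified with
  -- those of Aᵢ.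
  obtain ⟨hl, hm, -⟩ := (S.E i).conj_spectrum (g := π.mon (i + 1)) (l := (π.hyperbolic' i).lam)
    (m := (π.hyperbolic' i).mu) (n := (π.hyperbolic' i).nu)
    (by rw [← hrho]; exact (π.hyperbolic' i).hasSpectrum)
  have hback : ∀ x, ∀ v ∈ eigenspace (π.rho (peripheral' i)) x,
      (π.mon (i + 1))⁻¹ • v ∈ eigenspace (π.mon i) x := by
    intro x v hv
    rw [mem_eigenspace_iff, hrho] at hv
    rw [mem_eigenspace_iff, ← smul_comm (π.mon (i + 1))⁻¹ x v, ← hv, mul_smul, mul_smul,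
      inv_smul_smul]
  have hu := hback _ _ f.u_mem
  rw [hl] at hu
  have hw : (π.mon (i + 1))⁻¹ • f.w ∈
      eigenspace (π.mon i) (![π.lam i, π.mu i, π.nu i] 0) ⊔
        eigenspace (π.mon i) (![π.lam i, π.mu i, π.nu i] 1) := by
    obtain ⟨y, hy, z, hz, hyz⟩ := Submodule.mem_sup.1 f.w_mem
    rw [← hyz, smul_add, ← hl, ← hm]
    exact Submodule.add_mem_sup (hback _ _ hy) (hback _ _ hz)
  have hli : LinearIndependent ℝ ![(π.mon (i + 1))⁻¹ • f.u, (π.mon (i + 1))⁻¹ • f.w] := by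
    rw [LinearIndependent.pair_iff]
    intro a b hab
    refine LinearIndependent.pair_iff.1 f.indep a b ?_
    rw [← smul_comm (π.mon (i + 1))⁻¹, ← smul_comm (π.mon (i + 1))⁻¹, ← smul_add] at hab
    exact (smul_eq_zero_iff_eq _).1 hab
  obtain ⟨s, κ, hs, hκ, h1, h2⟩ := (S.E i).exists_scalars hu hw hli
  refine ⟨s, κ, hs, hκ, ?_, fun x => ?_⟩
  · rw [inv_smul_eq_iff, smul_comm] at h1
    exact h1
  · rw [← wedge3_smul (π.mon (i + 1))⁻¹]
    exact h2 _

end EigenSystem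

end ConvexProjectiveStructure

/-! ### Fock–Goncharov coordinates in terms of eigenvalues and volumes -/

namespace ConvexProjectiveStructure

namespace EigenSystem

variable {π : ConvexProjectiveStructure} (S : π.EigenSystem)

/-- The logarithm of the volume spanned by the lines of the flags `F₁, F₂, F₃`. -/
noncomputable def logVol (i : Fin 3) : ℝ :=
  Real.log (wedge3 (S.e (i + 1)) (S.e (i - 1)) (S.e i))

/-- The logarithm of the volume spanned by the lines of the flags `Fᵢ₊₁, Fᵢ₋₁, Fᵢ'`. -/
noncomputable def logVol' (i : Fin 3) : ℝ :=
  Real.log (wedge3 (S.e (i + 1)) (S.e (i - 1)) (π.mon (i + 1) • S.e i))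

/-- The scalars of the frames cancel. Besides the quotient of volumes there remains qᵢ₋₁(eᵢ') /
qᵢ₋₁(eᵢ) = 1 / (λᵢ νᵢ₋₁), where eᵢ' = Aᵢ₊₁ eᵢ. -/
theorem sigma1_eq (c : π.Frames) (i : Fin 3) :
    c.sigma1 i = S.logVol i - S.logVol' i - Real.log (π.lam i) - Real.log (π.nu (i - 1)) := by
  obtain ⟨-, -, -, -, -, hne, -⟩ := index_arith i
  obtain ⟨s₁, -, hs₁, -, hu₁, -⟩ := S.exists_frame_scalars (c.f (i + 1))
  obtain ⟨s₂, κ₂, hs₂, hκ₂, hu₂, hW₂⟩ := S.exists_frame_scalars (c.f (i - 1))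
  obtain ⟨s, -, hs, -, hu, -⟩ := S.exists_frame_scalars (c.f i)
  obtain ⟨s', -, hs', -, hu', -⟩ := S.exists_frame'_scalars (c.f' i)
  have hD := S.wedge_e_ne_zero i
  have hD' := S.wedge_e_mon_ne_zero i
  have hl := (S.lam_pos i).ne'
  have hn := (S.nu_pos (i - 1)).ne'
  have hq := (S.q_e_pos hne).ne'
  -- `Real.log` depends only on the absolute value, so nonvanishing of the wedge products suffices
  -- here.
  rw [Frames.sigma1, Real.log_neg_eq_log, wedge111, wedge111, wedge21, wedge21, hW₂, hW₂, hu₁, hu₂,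
    hu, hu', wedge3_smul_smul_smul, wedge3_smul_smul_smul, LinearMap.map_smul, LinearMap.map_smul,
    smul_eq_mul, smul_eq_mul, q_pred_mon_succ_e, logVol, logVol', ← Real.log_div hD hD',
    ← Real.log_div (div_ne_zero hD hD') hl, ← Real.log_div (div_ne_zero (div_ne_zero hD hD') hl) hn]
  congr 1
  field_simp

theorem sigma2_eq (c : π.Frames) (i : Fin 3) :
    c.sigma2 i = S.logVol' i - S.logVol i - Real.log (π.nu (i + 1)) := by
  obtain ⟨-, -, -, -, hne, -⟩ := index_arith i
  obtain ⟨s₁, κ₁, hs₁, hκ₁, hu₁, hW₁⟩ := S.exists_frame_scalars (c.f (i + 1))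
  obtain ⟨s₂, -, hs₂, -, hu₂, -⟩ := S.exists_frame_scalars (c.f (i - 1))
  obtain ⟨s, -, hs, -, hu, -⟩ := S.exists_frame_scalars (c.f i)
  obtain ⟨s', -, hs', -, hu', -⟩ := S.exists_frame'_scalars (c.f' i)
  have hD := S.wedge_e_ne_zero i
  have hD' := S.wedge_e_mon_ne_zero i
  have hn := (S.nu_pos (i + 1)).ne'
  have hq := (S.q_e_pos hne).ne'
  rw [Frames.sigma2, Real.log_neg_eq_log, wedge111, wedge111, wedge21, wedge21, hW₁, hW₁, hu₁, hu₂,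
    hu, hu', wedge3_smul_smul_smul, wedge3_smul_smul_smul, LinearMap.map_smul, LinearMap.map_smul,
    smul_eq_mul, smul_eq_mul, S.q_mon, logVol, logVol', ← Real.log_div hD' hD,
    ← Real.log_div (div_ne_zero hD' hD) hn]
  congr 1
  field_simp

include S in
-- Transporting the triple ratio of T₋ to F₁, F₂, F₃ gives the inverse of that of T₊ times the
-- product of all λᵢ and νᵢ, so only this product survives in the sum.
theorem tau111_add (c : π.Frames) : c.tau111Plus + c.tau111Minus =
    Real.log (π.lam 0) + Real.log (π.lam 1) + Real.log (π.lam 2) +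
      Real.log (π.nu 0) + Real.log (π.nu 1) + Real.log (π.nu 2) := by
  obtain ⟨s₀, κ₀, hs₀, hκ₀, hu₀, hW₀⟩ := S.exists_frame_scalars (c.f 0)
  obtain ⟨s₁, κ₁, hs₁, hκ₁, hu₁, hW₁⟩ := S.exists_frame_scalars (c.f 1)
  obtain ⟨s₂, κ₂, hs₂, hκ₂, hu₂, hW₂⟩ := S.exists_frame_scalars (c.f 2)
  obtain ⟨s', κ', hs', hκ', hu', hW'⟩ := S.exists_frame'_scalars (c.f' 1)
  have h12 : ∀ {F G : Flag} (f : Frame F) (g : Frame G), wedge12 f g = wedge3 g.u g.w f.u :=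
    fun f g => wedge3_rotate _ _ _
  have hq := fun {i j : Fin 3} (h : i ≠ j) => (S.q_e_pos h).ne'
  have q01 := hq (i := 0) (j := 1) (by decide)
  have q02 := hq (i := 0) (j := 2) (by decide)
  have q10 := hq (i := 1) (j := 0) (by decide)
  have q12 := hq (i := 1) (j := 2) (by decide)
  have q20 := hq (i := 2) (j := 0) (by decide)
  have q21 := hq (i := 2) (j := 1) (by decide)
  have hl := fun i => (S.lam_pos i).ne'
  have hn := fun i => (S.nu_pos i).ne'
  have hl0 := hl 0
  have hl1 := hl 1
  have hl2 := hl 2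
  have hn0 := hn 0
  have hn1 := hn 1
  have hn2 := hn 2
  have hplus : c.tau111Plus = Real.log (S.q 1 (S.e 2) / S.q 0 (S.e 2) *
      (S.q 0 (S.e 1) / S.q 2 (S.e 1)) * (S.q 2 (S.e 0) / S.q 1 (S.e 0))) := by
    simp only [Frames.tau111Plus, h12, wedge21, hW₀, hW₁, hW₂]
    simp only [hu₀, hu₁, hu₂, LinearMap.map_smul, smul_eq_mul]
    congr 1
    field_simp
  have e0 : S.q 1 ((π.mon 2)⁻¹ • S.e 0) = π.nu 1 * (π.lam 0 * S.q 1 (S.e 0)) := by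
    have h := π.mon_succ_inv 1 (S.e 0)
    change (π.mon 2)⁻¹ • S.e 0 = π.mon 1 • π.mon 0 • S.e 0 at h
    rw [h, S.q_mon, S.mon_e, LinearMap.map_smul, smul_eq_mul]
  have e2 : S.q 1 ((π.mon 2)⁻¹ • S.e 2) = (π.lam 2)⁻¹ * S.q 1 (S.e 2) := by
    rw [S.mon_inv_e, LinearMap.map_smul, smul_eq_mul]
  have e01 : S.q 0 (π.mon 2 • S.e 1) = (π.lam 1)⁻¹ * ((π.nu 0)⁻¹ * S.q 0 (S.e 1)) :=
    S.q_pred_mon_succ_e 1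
  have hminus : c.tau111Minus = Real.log (π.lam 0 * π.lam 1 * π.lam 2 * π.nu 0 * π.nu 1 * π.nu 2 /
      (S.q 1 (S.e 2) / S.q 0 (S.e 2) *
      (S.q 0 (S.e 1) / S.q 2 (S.e 1)) * (S.q 2 (S.e 0) / S.q 1 (S.e 0)))) := by
    have h12' : (1 + 1 : Fin 3) = 2 := rfl
    rw [h12'] at hu' hW'
    simp only [Frames.tau111Minus, h12, wedge21, hW₀, hW₂, hW']
    simp only [hu₀, hu₂, hu', LinearMap.map_smul, smul_eq_mul, S.q_mon, e01,
      smul_comm (π.mon 2)⁻¹ (_ : ℝ), e0, e2]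
    congr 1
    field_simp
  rw [hplus, hminus, Real.log_div (by simp [hl0, hl1, hl2, hn0, hn1, hn2])
    (by simp [q01, q02, q10, q12, q20, q21]), add_sub_cancel,
    Real.log_mul (by simp [hl0, hl1, hl2, hn0, hn1]) hn2,
    Real.log_mul (by simp [hl0, hl1, hl2, hn0]) hn1, Real.log_mul (by simp [hl0, hl1, hl2]) hn0,
    Real.log_mul (by simp [hl0, hl1]) hl2, Real.log_mul hl0 hl1]

theorem logVol_succ_eq_pred (i : Fin 3) : S.logVol (i + 1) = S.logVol (i - 1) := by
  obtain ⟨h1, h2, h3, h4, -⟩ := index_arith i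
  rw [logVol, logVol, h1, h2, h3, h4, wedge3_rotate]

theorem logVol'_relation (i : Fin 3) : Real.log (π.lam i) + S.logVol' (i - 1) =
    Real.log (π.lam (i + 1)) + S.logVol' (i + 1) := by
  obtain ⟨h1, h2, h3, h4, -⟩ := index_arith i
  have h5 := S.wedge_e_mon_ne_zero (i - 1)
  have h6 := S.wedge_e_mon_ne_zero (i + 1)
  rw [logVol', logVol', ← Real.log_mul (S.lam_pos _).ne' h5, ← Real.log_mul (S.lam_pos _).ne' h6,
    h1, h2, h3, h4, S.wedge_mon_relation]

include S in
theorem log_lam_add_log_mu_add_log_nu (i : Fin 3) :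
    Real.log (π.lam i) + Real.log (π.mu i) + Real.log (π.nu i) = 0 := by
  rw [← Real.log_mul (S.lam_pos i).ne' (S.mu_pos i).ne',
    ← Real.log_mul (mul_pos (S.lam_pos i) (S.mu_pos i)).ne' (S.nu_pos i).ne',
    S.lam_mul_mu_mul_nu, Real.log_one]

include S in
theorem tau111_add_cyclic (c : π.Frames) (i : Fin 3) : c.tau111Plus + c.tau111Minus =
    Real.log (π.lam i) + Real.log (π.lam (i + 1)) + Real.log (π.lam (i - 1)) +
      Real.log (π.nu i) + Real.log (π.nu (i + 1)) + Real.log (π.nu (i - 1)) := by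
  rw [S.tau111_add]
  fin_cases i
  · change _ = Real.log (π.lam 0) + Real.log (π.lam 1) + Real.log (π.lam 2) +
      Real.log (π.nu 0) + Real.log (π.nu 1) + Real.log (π.nu 2)
    ring
  · change _ = Real.log (π.lam 1) + Real.log (π.lam 2) + Real.log (π.lam 0) +
      Real.log (π.nu 1) + Real.log (π.nu 2) + Real.log (π.nu 0)
    ring
  · change _ = Real.log (π.lam 2) + Real.log (π.lam 0) + Real.log (π.lam 1) +
      Real.log (π.nu 2) + Real.log (π.nu 0) + Real.log (π.nu 1)
    ring

end EigenSystem

end ConvexProjectiveStructure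

end Pants

/-- Goldman's boundary invariants of a convex projective structure on the pair of pants, in terms
of its Fock–Goncharov coordinates (for any choice `c` of elements of the exterior powers of the
flags from which these coordinates are computed). -/
theorem proposition1 (π : Pants.ConvexProjectiveStructure) (c : π.Frames) (i : Fin 3) :
    π.lam i = Real.exp (1 / 3 * c.sigma1 (i + 1) + 2 / 3 * c.sigma2 (i + 1)
        + 2 / 3 * c.sigma1 (i - 1) + 1 / 3 * c.sigma2 (i - 1)
        + 2 / 3 * c.tau111Plus + 2 / 3 * c.tau111Minus) ∧
    π.tau i = (Real.exp (-c.sigma1 (i + 1) - c.sigma2 (i - 1)) + 1) *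
      Real.exp (1 / 3 * c.sigma1 (i + 1) - 1 / 3 * c.sigma2 (i + 1)
        - 1 / 3 * c.sigma1 (i - 1) + 1 / 3 * c.sigma2 (i - 1)
        - 1 / 3 * c.tau111Plus - 1 / 3 * c.tau111Minus) := by
  obtain ⟨S⟩ : Nonempty π.EigenSystem := inferInstance
  obtain ⟨h1, h2, h3, h4, -⟩ := Pants.index_arith i
  have hσ₁ := S.sigma1_eq c (i + 1)
  have hσ₂ := S.sigma2_eq c (i + 1)
  have hσ₁' := S.sigma1_eq c (i - 1)
  have hσ₂' := S.sigma2_eq c (i - 1)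
  rw [h2] at hσ₁
  rw [h1] at hσ₂
  rw [h4] at hσ₁'
  rw [h3] at hσ₂'
  have hτ := S.tau111_add_cyclic c i
  have hvol := S.logVol_succ_eq_pred i
  have hvol' := S.logVol'_relation i
  have hdet := S.log_lam_add_log_mu_add_log_nu i
  constructor
  · rw [← Real.exp_log (S.lam_pos i)]
    congr 1
    -- A linear identity in the logarithms: the volumes cancel through `hvol` and `hvol'`.
    linarith
  -- The second exponential is μᵢ and the first is νᵢ / μᵢ, which gives νᵢ + μᵢ. Here λμν = 1 enters
  -- through `hdet`.
  · have hμ : 1 / 3 * c.sigma1 (i + 1) - 1 / 3 * c.sigma2 (i + 1)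
        - 1 / 3 * c.sigma1 (i - 1) + 1 / 3 * c.sigma2 (i - 1)
        - 1 / 3 * c.tau111Plus - 1 / 3 * c.tau111Minus = Real.log (π.mu i) := by
      linarith
    have hν : -c.sigma1 (i + 1) - c.sigma2 (i - 1) =
        Real.log (π.nu i) - Real.log (π.mu i) := by
      linarith
    rw [hμ, hν, add_mul, ← Real.exp_add, sub_add_cancel, one_mul, Real.exp_log (S.nu_pos i),
      Real.exp_log (S.mu_pos i), add_comm]
    rfl
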